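/- Fix $m\ge 4$. A vote is a linear order (ranking) over a set $\mathcal A$ of $m$ alternatives, a profile is a vector of finitely many votes, and a voting rule $r$ maps every profile (with any number of voters) to a single winner. An alternative $a$ is the Condorcet winner of a profile $P$ if for every $b\ne a$ strictly more votes of $P$ prefer $a$ to $b$ than prefer $b$ to $a$. The rule $r$ satisfies the Condorcet criterion at $P$ if, whenever $P$ has a Condorcet winner, it is $r(P)$. The rule $r$ satisfies group participation at $P$ for groups of size at most $B$ if there is no non-empty set $S$ of at most $B$ voters such that every voter in $S$ strictly prefers $r(P_{-S})$ to $r(P)$, where $P_{-S}$ is $P$ with the votes of $S$ removed. Write $\mathrm{C\&P}(r,P,B)$ if both hold. For a set $\Pi$ of probability distributions over the rankings, let $$\widetilde{\mathrm{C\&P}}^{\min}_{\Pi}(r,n,B)=\inf_{\vec\pi\in\Pi^n}\Pr_{P\sim\vec\pi}\big(\mathrm{C\&P}(r,P,B)\big),$$ where the $n$ votes of $P$ are independent and the $j$-th vote is drawn from $\pi_j$. Then there is $N$, depending only on $m$, such that the following holds for every $\Pi$ for which (i) there is $\epsilon>0$ with $\pi(R)\ge\epsilon$ for all $\pi\in\Pi$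 and all rankings $R$, (ii) $\Pi$ is closed, and (iii) the uniform distribution lies in the convex hull of $\Pi$. There is a constant $c>0$, depending only on $m$ and $\Pi$, such that for every voting rule $r$, every $n\ge N$ and every integer $1\le B\le\sqrt n$, $$\widetilde{\mathrm{C\&P}}^{\min}_{\Pi}(r,n,B)\le 1-c\,\frac{B}{\sqrt n}.$$ -/

import Mathlib

open scoped BigOperators

namespace SemiRandomVoting

/-- A linear order over the `m` alternatives, given by the position of each alternative:
`R a = 0` means that `a` is ranked at the top. Permutations of `Fin m` are in bijection with the
linear orders over `Fin m`. -/
abbrev Ranking (m : ℕ) : Type := Equiv.Perm (Fin m)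

/-- `a ≻_R b`: a voter with vote `R` (strictly) prefers `a` to `b`. -/
def Prefers {m : ℕ} (R : Ranking m) (a b : Fin m) : Prop := R a < R b

instance {m : ℕ} (R : Ranking m) (a b : Fin m) : Decidable (Prefers R a b) :=
  inferInstanceAs (Decidable (R a < R b))

/-- An `n`-profile: the vector of the votes of `n` voters. -/
abbrev Profile (m n : ℕ) : Type := Fin n → Ranking m

/-- A voting rule maps any profile, with any number of voters, to a single winner. -/
abbrev VotingRule (m : ℕ) : Type := (n : ℕ) → Profile m n → Fin m

/-- `P[a ≻ b]`: the number of votes in `P` in which `a` is preferred to `b`. -/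
def supportCount {m n : ℕ} (P : Profile m n) (a b : Fin m) : ℕ :=
  (Finset.univ.filter fun i : Fin n => Prefers (P i) a b).card

/-- The weight on the edge `a → b` of the weighted majority graph of `P`. -/
def wmg {m n : ℕ} (P : Profile m n) (a b : Fin m) : ℤ :=
  (supportCount P a b : ℤ) - (supportCount P b a : ℤ)

/-- `a` is the Condorcet winner of `P`: all its outgoing edges have positive weight. -/
def IsCondorcetWinner {m n : ℕ} (P : Profile m n) (a : Fin m) : Prop :=
  ∀ b : Fin m, b ≠ a → 0 < wmg P a b

/-- The profile left after the voters in `S` abstain; the others keep their order. -/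
def abstain {m n : ℕ} (P : Profile m n) (S : Finset (Fin n)) : Profile m Sᶜ.card :=
  fun i => P (Sᶜ.orderEmbOfFin rfl i)

/-- A per-profile axiom: whether a voting rule satisfies it at a profile, with respect to a
group size. -/
abbrev PerProfileAxiom (m : ℕ) : Type := VotingRule m → (n : ℕ) → Profile m n → ℕ → Prop

/-- The Condorcet criterion (which does not depend on the group size). -/
def CC (m : ℕ) : PerProfileAxiom m := fun r n P _ =>
  ∀ a : Fin m, IsCondorcetWinner P a → r n P = a

/-- Group participation: there is no (non-empty) group of at most `B` voters each of whom
prefers the winner after the group abstains to the current winner. -/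
def Par (m : ℕ) : PerProfileAxiom m := fun r n P B =>
  ¬ ∃ S : Finset (Fin n), S.Nonempty ∧ S.card ≤ B ∧
    ∀ i ∈ S, Prefers (P i) (r Sᶜ.card (abstain P S)) (r n P)

/-- The Condorcet criterion and group participation together. -/
def CAndP (m : ℕ) : PerProfileAxiom m := fun r n P B => CC m r n P B ∧ Par m r n P B

/-- The probability of the event `E` when the votes are drawn independently, the vote of voter
`i` from the distribution `π i`. -/
noncomputable def profileProb {m n : ℕ} (π : Fin n → Ranking m → ℝ)
    (E : Profile m n → Prop) : ℝ :=
  open Classical in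
  ∑ P ∈ Finset.univ.filter (fun P : Profile m n => E P), ∏ i : Fin n, π i (P i)

/-- The semi-random (worst-case over `Π^n`) satisfaction of the axiom `X` under `r`. -/
noncomputable def satMin {m : ℕ} (X : PerProfileAxiom m) (Pi : Set (Ranking m → ℝ))
    (r : VotingRule m) (n B : ℕ) : ℝ :=
  ⨅ π : Fin n → Pi, profileProb (fun i => (π i : Ranking m → ℝ)) (fun P => X r n P B)

/-- The uniform distribution over rankings. -/
noncomputable def uniformRanking (m : ℕ) : Ranking m → ℝ :=
  fun _ => 1 / (Fintype.card (Ranking m) : ℝ)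

/-- The standing assumption on the set of vote distributions. -/
structure IsAdmissible {m : ℕ} (Pi : Set (Ranking m → ℝ)) : Prop where
  /-- The elements are probability distributions over rankings. -/
  subset_simplex : Pi ⊆ stdSimplex ℝ (Ranking m)
  /-- Every ranking has probability bounded away from zero, uniformly in the distribution. -/
  strictly_positive : ∃ ε : ℝ, 0 < ε ∧ ∀ π ∈ Pi, ∀ R : Ranking m, ε ≤ π R
  /-- The set is closed. -/
  closed : IsClosed Pi
  /-- The uniform distribution is in the convex hull. -/
  uniform_mem : uniformRanking m ∈ convexHull ℝ Pi

end SemiRandomVoting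

/-!
The uniform distribution is an average of elements of `Pi`, so a product of uniform votes is an
average of products of elements of `Pi`, and the worst case over `Pi` is at most the satisfaction
under independent uniform votes (`satMin_le_profileProb_uniform`). It remains to find a fraction of
order `B / √n` of all profiles at which one of the two axioms fails.

The source of the violations is a version of Moulin's no-show paradox in which all profiles have
`n` voters (`IsGrid.exists_displacement_not_cAndP`). Let a group of at most `B` voters with the
vote `R` change to the vote `R'`. Both profiles lead to the same profile when the group abstains,
so participation at both of them keeps the winner in any set that is closed downwards in `R` and
upwards in `R'`. With the vote `rest ≻ y' ≻ y` changed to `y ≻ y' ≻ rest`, a winner `y` remains the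
winner until `y'` is the Condorcet winner, if the initial margins permit this. Suitable margins of
order `√n` exclude in this way all but one alternative; a further exchange of votes restricts the
winner to two alternatives, and these are then both excluded. The whole argument exchanges `O(√n)`
votes, in `O(√n / B)` groups of size `B`, so one of these `O(√n / B)` profiles is a violation.

To count the violations, a uniform vote is drawn as a uniform pair of rankings followed by a fair
coin. Given the pairs, and given an order of the voters within each class of equal pairs, the
numbers of coins showing the second ranking are the coordinates of a grid, on which each exchange
of votes is a move parallel to an axis. The starting points fill a cube whose side is of order
`√n`, and each grid point is the violation found from `O(√n / B)` of them, so there are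
`Ω(B / √n)` times as many violations as points of the cube
(`IsGrid.pow_le_card_displacements_mul`). The coordinates are independent binomial variables, and
every point in question has its coordinates within `O(√n)` of the centre, where the binomial weights
are at least of order `1 / √n` (`two_pow_le_choose_mul`). By Chebyshev's inequality, at least half
of the assignments of pairs leave the relevant region within reach (`half_le_card_typical`).
-/

namespace SemiRandomVoting

/-! ### Reduction to independent uniform votes -/

/-- A product of mixtures is a mixture of products. -/
theorem sum_prod_mul_profileProb {m n : ℕ} {ι : Type*} [Fintype ι] (w : ι → ℝ)
    (p : ι → Ranking m → ℝ) (E : Profile m n → Prop) :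
    ∑ j : Fin n → ι, (∏ i, w (j i)) * profileProb (fun i => p (j i)) E =
      profileProb (fun _ : Fin n => ∑ l, w l • p l) E := by
  classical
  unfold profileProb
  simp_rw [Finset.mul_sum]
  rw [Finset.sum_comm]
  refine Finset.sum_congr rfl fun P _ => ?_
  simp_rw [← Finset.prod_mul_distrib, Finset.sum_apply, Pi.smul_apply, smul_eq_mul]
  rw [Finset.prod_univ_sum, Fintype.piFinset_univ]

theorem profileProb_nonneg {m n : ℕ} {π : Fin n → Ranking m → ℝ} (hπ : ∀ i R, 0 ≤ π i R)
    (E : Profile m n → Prop) : 0 ≤ profileProb π E :=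
  Finset.sum_nonneg fun _ _ => Finset.prod_nonneg fun _ _ => hπ _ _

/-- If the distributions `π i` are drawn independently from a mixture of elements of `Pi` whose
average is uniform, the votes become independent and uniform; hence the worst case over `Pi` is at
most the satisfaction under the uniform distribution. -/
theorem satMin_le_profileProb_uniform {m : ℕ} {Pi : Set (Ranking m → ℝ)} (hPi : IsAdmissible Pi)
    (X : PerProfileAxiom m) (r : VotingRule m) (n B : ℕ) :
    satMin X Pi r n B ≤
      profileProb (fun _ : Fin n => uniformRanking m) (fun P => X r n P B) := by
  obtain ⟨ι, _, w, p, hw0, hw1, hp, hsum⟩ := mem_convexHull_iff_exists_fintype.1 hPi.uniform_mem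
  have hbdd : BddBelow (Set.range fun π : Fin n → Pi =>
      profileProb (fun i => (π i : Ranking m → ℝ)) (fun P => X r n P B)) := by
    refine ⟨0, ?_⟩
    rintro _ ⟨π, rfl⟩
    exact profileProb_nonneg (fun i R => (hPi.subset_simplex (π i).2).1 R) _
  have hle : ∀ j : Fin n → ι,
      satMin X Pi r n B ≤ profileProb (fun i => p (j i)) (fun P => X r n P B) := fun j =>
    ciInf_le hbdd (fun i => (⟨p (j i), hp (j i)⟩ : Pi))
  have hone : ∑ j : Fin n → ι, ∏ i, w (j i) = 1 := by
    have := Finset.prod_univ_sum (fun _ : Fin n => (Finset.univ : Finset ι)) (fun _ l => w l)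
    rw [Fintype.piFinset_univ] at this
    rw [← this, hw1, Finset.prod_const_one]
  calc satMin X Pi r n B = ∑ j : Fin n → ι, (∏ i, w (j i)) * satMin X Pi r n B := by
        rw [← Finset.sum_mul, hone, one_mul]
    _ ≤ ∑ j : Fin n → ι, (∏ i, w (j i)) *
          profileProb (fun i => p (j i)) (fun P => X r n P B) :=
        Finset.sum_le_sum fun j _ =>
          mul_le_mul_of_nonneg_left (hle j) (Finset.prod_nonneg fun _ _ => hw0 _)
    _ = _ := by rw [sum_prod_mul_profileProb, hsum]

open Classical in
theorem profileProb_uniform {m n : ℕ} (E : Profile m n → Prop) :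
    profileProb (fun _ : Fin n => uniformRanking m) E =
      1 - ((Finset.univ.filter fun P : Profile m n => ¬ E P).card : ℝ) / (m.factorial : ℝ) ^ n := by
  have hq : (m.factorial : ℝ) ^ n ≠ 0 := by positivity
  have hcard := Finset.card_filter_add_card_filter_not
    (s := (Finset.univ : Finset (Profile m n))) (fun P => E P)
  have htot : (Finset.univ : Finset (Profile m n)).card = m.factorial ^ n := by
    rw [Finset.card_univ, Fintype.card_fun, Fintype.card_perm, Fintype.card_fin, Fintype.card_fin]
  rw [htot] at hcard
  have hcard' : ((Finset.univ.filter fun P : Profile m n => E P).card : ℝ) +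
      ((Finset.univ.filter fun P : Profile m n => ¬ E P).card : ℝ) = (m.factorial : ℝ) ^ n := by
    exact_mod_cast hcard
  unfold profileProb uniformRanking
  simp only [Finset.prod_const, Finset.card_univ, Fintype.card_fin, Finset.sum_const,
    nsmul_eq_mul, Fintype.card_perm, one_div_pow]
  field_simp
  linarith

/-! ### Margins and exchanging groups of votes -/

/-- The contribution of a single vote to the weight on the edge `a → b`. -/
def voteMargin {m : ℕ} (R : Ranking m) (a b : Fin m) : ℤ :=
  (if R a < R b then 1 else 0) - (if R b < R a then 1 else 0)

theorem wmg_eq_sum_voteMargin {m n : ℕ} (P : Profile m n) (a b : Fin m) :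
    wmg P a b = ∑ i, voteMargin (P i) a b := by
  simp only [wmg, supportCount, voteMargin, Prefers, Finset.sum_sub_distrib, Finset.sum_boole]
  rfl

theorem abs_voteMargin_le {m : ℕ} (R : Ranking m) (a b : Fin m) : |voteMargin R a b| ≤ 1 := by
  unfold voteMargin
  split_ifs <;> simp

theorem voteMargin_swap {m : ℕ} (R : Ranking m) (a b : Fin m) :
    voteMargin R b a = - voteMargin R a b := by
  unfold voteMargin
  ring

/-- `coinProfile z A`: voter `i` votes `(z i).2` when `i ∈ A` and `(z i).1` otherwise. -/
def coinProfile {m n : ℕ} (z : Fin n → Ranking m × Ranking m) (A : Finset (Fin n)) :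
    Profile m n := fun i => if i ∈ A then (z i).2 else (z i).1

/-- The number of elements of `A` in the class `k` of `z`. -/
def classCount {n : ℕ} {K : Type*} [DecidableEq K] (z : Fin n → K) (A : Finset (Fin n)) (k : K) :
    ℕ := (A.filter fun i => z i = k).card

/-- The change of the weight on `a → b` when a vote `k.1` is replaced by `k.2`. -/
def swapMargin {m : ℕ} (k : Ranking m × Ranking m) (a b : Fin m) : ℤ :=
  voteMargin k.2 a b - voteMargin k.1 a b

theorem wmg_coinProfile {m n : ℕ} (z : Fin n → Ranking m × Ranking m) (A : Finset (Fin n))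
    (a b : Fin m) :
    wmg (coinProfile z A) a b = ∑ i, voteMargin (z i).1 a b +
      ∑ k, (classCount z A k : ℤ) * swapMargin k a b := by
  have h1 : ∀ i, voteMargin (coinProfile z A i) a b =
      voteMargin (z i).1 a b + if i ∈ A then swapMargin (z i) a b else 0 := by
    intro i
    unfold coinProfile swapMargin
    split_ifs <;> ring
  rw [wmg_eq_sum_voteMargin, Finset.sum_congr rfl fun i _ => h1 i, Finset.sum_add_distrib]
  congr 1
  rw [← Finset.sum_filter, Finset.filter_mem_eq_inter, Finset.univ_inter,
    ← Finset.sum_fiberwise_of_maps_to (g := z) (t := Finset.univ) (fun _ _ => Finset.mem_univ _)]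
  refine Finset.sum_congr rfl fun k _ => ?_
  rw [Finset.sum_congr rfl (g := fun _ => swapMargin k a b)]
  · simp [classCount]
  · intro i hi
    rw [(Finset.mem_filter.1 hi).2]

/-- If the members of a small group change their common vote `R` to `R'`, and `L` is closed
downwards in `R` and upwards in `R'`, then participation at both profiles keeps the winner in `L`:
both profiles lead to the same profile when the group abstains. -/
theorem winner_mem_of_exchange {m n B : ℕ} {r : VotingRule m} {P Q : Profile m n}
    {S : Finset (Fin n)} {R R' : Ranking m} {L : Set (Fin m)} (hS : S.Nonempty) (hSB : S.card ≤ B)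
    (hP : ∀ i ∈ S, P i = R) (hQ : ∀ i ∈ S, Q i = R') (hPQ : ∀ i ∉ S, P i = Q i)
    (hL : ∀ y ∈ L, ∀ w, R y ≤ R w → w ∈ L) (hL' : ∀ y ∈ L, ∀ w, R' w ≤ R' y → w ∈ L)
    (hparP : Par m r n P B) (hparQ : Par m r n Q B) (hmem : r n P ∈ L) : r n Q ∈ L := by
  have habs : abstain P S = abstain Q S := by
    funext i
    exact hPQ _ (Finset.mem_compl.1 (Finset.orderEmbOfFin_mem _ rfl i))
  have key : ∀ {P : Profile m n} {R : Ranking m}, (∀ i ∈ S, P i = R) → Par m r n P B →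
      R (r n P) ≤ R (r Sᶜ.card (abstain P S)) := by
    intro P R hP hpar
    by_contra! hlt
    exact hpar ⟨S, hS, hSB, fun i hi => by rw [hP i hi]; exact hlt⟩
  have h1 := key hP hparP
  have h2 := key hQ hparQ
  rw [← habs] at h2
  exact hL' _ (hL _ hmem _ h1) _ h2

/-- A grid of subsets of the voters: it is monotone, and `g x` has `x k` elements in each
class `k`. -/
structure IsGrid {n : ℕ} {K : Type*} [DecidableEq K] (z : Fin n → K)
    (g : (K → ℕ) → Finset (Fin n)) : Prop where
  mono : Monotone g
  count : ∀ x ≤ classCount z Finset.univ, ∀ k, classCount z (g x) k = x k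

/-- Moving a grid point by at most `B` in the direction `k` exchanges at most `B` votes `k.1` for
votes `k.2`. -/
theorem IsGrid.winner_mem_of_step {m n B s : ℕ} {r : VotingRule m}
    {z : Fin n → Ranking m × Ranking m} {g : (Ranking m × Ranking m → ℕ) → Finset (Fin n)}
    (hg : IsGrid z g) {x : Ranking m × Ranking m → ℕ} {k : Ranking m × Ranking m}
    {L : Set (Fin m)} (hL : ∀ y ∈ L, ∀ w, k.1 y ≤ k.1 w → w ∈ L)
    (hL' : ∀ y ∈ L, ∀ w, k.2 w ≤ k.2 y → w ∈ L) (hs : 0 < s) (hsB : s ≤ B)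
    (hx : x + Pi.single k s ≤ classCount z Finset.univ)
    (hparP : Par m r n (coinProfile z (g x)) B)
    (hparQ : Par m r n (coinProfile z (g (x + Pi.single k s))) B)
    (hmem : r n (coinProfile z (g x)) ∈ L) :
    r n (coinProfile z (g (x + Pi.single k s))) ∈ L := by
  set y := x + Pi.single k s with hy
  have hxy : x ≤ y := le_self_add
  have hsub : g x ⊆ g y := hg.mono hxy
  have hcx := hg.count x fun l => (hxy l).trans (hx l)
  have hcy := hg.count y hx
  have hfil : ∀ l, ((g y \ g x).filter fun i => z i = l).card = y l - x l := by
    intro l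
    rw [← hcx l, ← hcy l, classCount, classCount, ← Finset.card_sdiff_of_subset
      (Finset.filter_subset_filter _ hsub)]
    congr 1
    ext i
    simp only [Finset.mem_filter, Finset.mem_sdiff]
    tauto
  have hclass : ∀ i ∈ g y \ g x, z i = k := by
    intro i hi
    by_contra hne
    have h0 : ((g y \ g x).filter fun j => z j = z i).card = 0 := by
      rw [hfil, hy, Pi.add_apply, Pi.single_eq_of_ne hne]; simp
    exact Finset.notMem_empty i ((Finset.card_eq_zero.1 h0) ▸ Finset.mem_filter.2 ⟨hi, rfl⟩)
  have hcard : (g y \ g x).card = s := by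
    have := hfil k
    rw [Finset.filter_true_of_mem hclass] at this
    rw [this, hy, Pi.add_apply, Pi.single_eq_same]; simp
  refine winner_mem_of_exchange (S := g y \ g x) (R := k.1) (R' := k.2)
    (Finset.card_pos.1 (hcard ▸ hs)) (hcard ▸ hsB) ?_ ?_ ?_ hL hL' hparP hparQ hmem
  · intro i hi
    rw [coinProfile, if_neg (Finset.mem_sdiff.1 hi).2, hclass i hi]
  · intro i hi
    rw [coinProfile, if_pos (Finset.mem_sdiff.1 hi).1, hclass i hi]
  · intro i hi
    have : i ∈ g x ↔ i ∈ g y := ⟨fun h => hsub h, fun h => by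
      by_contra h'
      exact hi (Finset.mem_sdiff.2 ⟨h, h'⟩)⟩
    simp only [coinProfile, this]

/-- The exchange of `t` groups of size `B`, one after the other. -/
theorem IsGrid.winner_mem_of_chain {m n B : ℕ} {r : VotingRule m}
    {z : Fin n → Ranking m × Ranking m} {g : (Ranking m × Ranking m → ℕ) → Finset (Fin n)}
    (hg : IsGrid z g) {x : Ranking m × Ranking m → ℕ} {k : Ranking m × Ranking m}
    {L : Set (Fin m)} (hL : ∀ y ∈ L, ∀ w, k.1 y ≤ k.1 w → w ∈ L)
    (hL' : ∀ y ∈ L, ∀ w, k.2 w ≤ k.2 y → w ∈ L) (hB : 0 < B) (t : ℕ)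
    (hx : x + Pi.single k (t * B) ≤ classCount z Finset.univ)
    (hpar : ∀ j ≤ t, Par m r n (coinProfile z (g (x + Pi.single k (j * B)))) B)
    (hmem : r n (coinProfile z (g x)) ∈ L) :
    r n (coinProfile z (g (x + Pi.single k (t * B)))) ∈ L := by
  induction t with
  | zero => simpa using hmem
  | succ t ih =>
    have hsplit : x + Pi.single k ((t + 1) * B) = x + Pi.single k (t * B) + Pi.single k B := by
      rw [add_assoc, ← Pi.single_add, Nat.succ_mul]
    have hprev := ih (fun l => le_trans (by rw [hsplit]; exact Nat.le_add_right _ _) (hx l))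
      fun j hj => hpar j (hj.trans t.le_succ)
    have hlast := hpar (t + 1) le_rfl
    rw [hsplit] at hx hlast ⊢
    exact hg.winner_mem_of_step hL hL' hB le_rfl hx (hpar t t.le_succ) hlast hprev

theorem IsGrid.wmg_add_single {m n : ℕ} {z : Fin n → Ranking m × Ranking m}
    {g : (Ranking m × Ranking m → ℕ) → Finset (Fin n)} (hg : IsGrid z g)
    {x : Ranking m × Ranking m → ℕ} {k : Ranking m × Ranking m} {s : ℕ}
    (hx : x + Pi.single k s ≤ classCount z Finset.univ) (a b : Fin m) :
    wmg (coinProfile z (g (x + Pi.single k s))) a b =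
      wmg (coinProfile z (g x)) a b + s * swapMargin k a b := by
  rw [wmg_coinProfile, wmg_coinProfile, add_assoc]
  congr 1
  have hx' : ∀ l, x l ≤ classCount z Finset.univ l := fun l =>
    le_trans (Nat.le_add_right _ _) (hx l)
  simp_rw [hg.count _ hx, hg.count _ hx', Pi.add_apply, Nat.cast_add, add_mul,
    Finset.sum_add_distrib]
  congr 1
  rw [Finset.sum_eq_single k]
  · rw [Pi.single_eq_same]
  · intro l _ hl
    rw [Pi.single_eq_of_ne hl]; simp
  · simp

/-! ### Particular pairs of rankings -/

theorem exists_ranking_apply_eq {m : ℕ} {y y' p p' : Fin m} (hy : y ≠ y') (hp : p ≠ p') :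
    ∃ R : Ranking m, R y = p ∧ R y' = p' := by
  refine ⟨(Equiv.swap y p).trans (Equiv.swap (Equiv.swap y p y') p'), ?_, by simp⟩
  have h : p ≠ Equiv.swap y p y' := by
    intro h
    have : Equiv.swap y p y = Equiv.swap y p y' := by rw [Equiv.swap_apply_left, ← h]
    exact hy ((Equiv.swap y p).injective this)
  simp [Equiv.swap_apply_of_ne_of_ne h hp]

/-- Replacing `rest ≻ y' ≻ y` by `y ≻ y' ≻ rest`: `y'` loses two votes against `y` and gains two
against all others. -/
theorem exists_exclusion_pair {m : ℕ} {y y' : Fin m} (hy : y ≠ y') :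
    ∃ k : Ranking m × Ranking m, (∀ w, k.1 y ≤ k.1 w → w = y) ∧ (∀ w, k.2 w ≤ k.2 y → w = y) ∧
      swapMargin k y' y = -2 ∧ ∀ c, c ≠ y → c ≠ y' → swapMargin k y' c = 2 := by
  have hm : 2 ≤ m := by
    have := y.2; have := y'.2
    have : (y : ℕ) ≠ y' := fun h => hy (Fin.ext h)
    omega
  obtain ⟨R, hR, hR'⟩ := exists_ranking_apply_eq (p := (⟨m - 1, by omega⟩ : Fin m))
    (p' := ⟨m - 2, by omega⟩) hy (by simp; omega)
  obtain ⟨Q, hQ, hQ'⟩ := exists_ranking_apply_eq (p := (⟨0, by omega⟩ : Fin m))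
    (p' := ⟨1, by omega⟩) hy (by simp)
  have hRi : ∀ {v w : Fin m}, (R v : ℕ) = R w → v = w := fun h => R.injective (Fin.ext h)
  have hQi : ∀ {v w : Fin m}, (Q v : ℕ) = Q w → v = w := fun h => Q.injective (Fin.ext h)
  have eR : (R y : ℕ) = m - 1 := by rw [hR]
  have eR' : (R y' : ℕ) = m - 2 := by rw [hR']
  have eQ : (Q y : ℕ) = 0 := by rw [hQ]
  have eQ' : (Q y' : ℕ) = 1 := by rw [hQ']
  refine ⟨(R, Q), fun w hw => ?_, fun w hw => ?_, ?_, fun c hc hc' => ?_⟩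
  · have h2 := (R w).2
    have h3 : (R y : ℕ) ≤ R w := hw
    exact hRi (by omega)
  · have h3 : (Q w : ℕ) ≤ Q y := hw
    exact hQi (by omega)
  · simp only [swapMargin, voteMargin, Fin.lt_def, eR, eR', eQ, eQ']
    rw [if_neg (by omega), if_pos (by omega), if_pos (by omega), if_neg (by omega)]; norm_num
  · have h1 : (R c : ℕ) ≠ R y := fun h => hc (hRi h)
    have h2 : (R c : ℕ) ≠ R y' := fun h => hc' (hRi h)
    have h3 : (Q c : ℕ) ≠ Q y := fun h => hc (hQi h)
    have h4 : (Q c : ℕ) ≠ Q y' := fun h => hc' (hQi h)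
    have h5 := (R c).2
    simp only [swapMargin, voteMargin, Fin.lt_def, eR', eQ']
    rw [if_pos (by omega), if_neg (by omega), if_neg (by omega), if_pos (by omega)]; norm_num

/-- Two rankings that differ only in the order of the top two alternatives `i` and `j`. -/
theorem exists_elementary_pair {m : ℕ} {i j : Fin m} (hij : i ≠ j) :
    ∃ k : Ranking m × Ranking m, ∀ a b, swapMargin k a b =
      (if a = i ∧ b = j then 2 else 0) - (if a = j ∧ b = i then 2 else 0) := by
  have hm : 2 ≤ m := by
    have := i.2; have := j.2
    have : (i : ℕ) ≠ j := fun h => hij (Fin.ext h)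
    omega
  obtain ⟨Q, hQ, hQ'⟩ := exists_ranking_apply_eq (p := (⟨0, by omega⟩ : Fin m))
    (p' := ⟨1, by omega⟩) hij (by simp)
  have hQi : ∀ {v w : Fin m}, (Q v : ℕ) = Q w → v = w := fun h => Q.injective (Fin.ext h)
  have eQ : (Q i : ℕ) = 0 := by rw [hQ]
  have eQ' : (Q j : ℕ) = 1 := by rw [hQ']
  have hother : ∀ a, a ≠ i → a ≠ j → 2 ≤ (Q a : ℕ) := by
    intro a h1 h2
    have h3 : (Q a : ℕ) ≠ Q i := fun h => h1 (hQi h)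
    have h4 : (Q a : ℕ) ≠ Q j := fun h => h2 (hQi h)
    omega
  refine ⟨((Equiv.swap i j).trans Q, Q), fun a b => ?_⟩
  simp only [swapMargin, voteMargin, Fin.lt_def, Equiv.trans_apply]
  by_cases ai : a = i
  · subst ai
    by_cases bi : b = a
    · subst bi; simp [hij]
    · by_cases bj : b = j
      · subst bj; simp [eQ, eQ', hij.symm]
      · have := hother b bi bj
        rw [Equiv.swap_apply_left, Equiv.swap_apply_of_ne_of_ne bi bj, eQ, eQ']
        simp only [bi, bj, and_false, if_false]
        rw [if_pos (by omega), if_neg (by omega), if_pos (by omega), if_neg (by omega)]; norm_num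
  · by_cases aj : a = j
    · subst aj
      by_cases bi : b = i
      · subst bi; simp [eQ, eQ', ai]
      · by_cases bj : b = a
        · subst bj; simp [hij.symm]
        · have := hother b bi bj
          rw [Equiv.swap_apply_right, Equiv.swap_apply_of_ne_of_ne bi bj, eQ, eQ']
          simp only [bi, bj, and_false, if_false]
          rw [if_pos (by omega), if_neg (by omega), if_pos (by omega), if_neg (by omega)]; norm_num
    · have := hother a ai aj
      rw [Equiv.swap_apply_of_ne_of_ne ai aj]
      simp only [ai, aj, false_and, if_false]
      by_cases bi : b = i
      · subst bi
        rw [Equiv.swap_apply_left, eQ, eQ']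
        rw [if_neg (by omega), if_pos (by omega), if_neg (by omega), if_pos (by omega)]; norm_num
      · by_cases bj : b = j
        · subst bj
          rw [Equiv.swap_apply_right, eQ, eQ']
          rw [if_neg (by omega), if_pos (by omega), if_neg (by omega), if_pos (by omega)]; norm_num
        · rw [Equiv.swap_apply_of_ne_of_ne bi bj]; ring

/-! ### The no-show argument on a grid -/

/-- If `y'` beats `y` by more than `2 s` and loses to every other alternative by less than `2 s`,
then `y` cannot be the winner: replacing `s` votes `rest ≻ y' ≻ y` by `y ≻ y' ≻ rest` keeps `y`
the winner but makes `y'` the Condorcet winner. -/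
theorem IsGrid.winner_ne_of_margins {m n B : ℕ} {r : VotingRule m}
    {z : Fin n → Ranking m × Ranking m} {g : (Ranking m × Ranking m → ℕ) → Finset (Fin n)}
    (hg : IsGrid z g) {x : Ranking m × Ranking m → ℕ} (hB : 0 < B) (t : ℕ)
    (hx : ∀ k, x k + t * B ≤ classCount z Finset.univ k)
    (hgood : ∀ k, ∀ j ≤ t, CAndP m r n (coinProfile z (g (x + Pi.single k (j * B)))) B)
    {y y' : Fin m} (hy : y ≠ y') (hlt : 2 * ((t * B : ℕ) : ℤ) < wmg (coinProfile z (g x)) y' y)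
    (hpos : ∀ c, c ≠ y → c ≠ y' → 0 < wmg (coinProfile z (g x)) y' c + 2 * ((t * B : ℕ) : ℤ)) :
    r n (coinProfile z (g x)) ≠ y := by
  intro hwin
  obtain ⟨k, hk, hk', hmy, hmc⟩ := exists_exclusion_pair hy
  have hx' : x + Pi.single k (t * B) ≤ classCount z Finset.univ := by
    intro l
    refine le_trans ?_ (hx l)
    rw [Pi.add_apply]
    refine Nat.add_le_add_left ?_ _
    rcases eq_or_ne l k with rfl | hl
    · rw [Pi.single_eq_same]
    · rw [Pi.single_eq_of_ne hl]; exact Nat.zero_le _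
  have hmem := hg.winner_mem_of_chain (L := {y}) (k := k)
    (fun v hv w hw => hk w (by rwa [Set.mem_singleton_iff.1 hv] at hw))
    (fun v hv w hw => hk' w (by rwa [Set.mem_singleton_iff.1 hv] at hw)) hB t hx'
    (fun j hj => (hgood k j hj).2) hwin
  have hcw := (hgood k t le_rfl).1 y' fun c hc => by
    rw [hg.wmg_add_single hx']
    rcases eq_or_ne c y with rfl | hcy
    · rw [hmy]; linarith
    · rw [hmc c hcy hc]; linarith [hpos c hcy hc]
  exact hy (hmem.symm.trans hcw)

/-- The antisymmetric matrix with the entries `f i j` above the diagonal. -/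
def antisymmetrize {m : ℕ} (f : ℕ → ℕ → ℤ) (i j : Fin m) : ℤ :=
  if i < j then f i j else if j < i then - f j i else 0

/-- The margins, in multiples of a unit of order `√n`, at the start of the argument. Write
`c, a, b, d` for the alternatives `0, 1, 2, 3`. Every other alternative loses to these four; `a`
excludes `d` and the others, and `d` excludes `b` and `c`, so `a` must win. -/
def startMargin : ℕ → ℕ → ℤ
  | 0, 1 => 7
  | 0, 2 => -10
  | 0, 3 => -9
  | 1, 2 => 0
  | 1, 3 => 8
  | 2, 3 => -9
  | _, _ => 20

/-- The margins after votes `others ≻ d ≻ b ≻ c ≻ a` were replaced by `c ≻ a ≻ b ≻ d ≻ others`.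
Participation keeps the winner in `{a, c}`, but now `c` excludes `a`, and `b` excludes `c`. -/
def endMargin : ℕ → ℕ → ℤ
  | 0, 1 => 7
  | 0, 2 => -6
  | 0, 3 => -5
  | 1, 2 => 4
  | 1, 3 => 12
  | 2, 3 => -5
  | _, _ => 24

/-- The rankings `others ≻ d ≻ b ≻ c ≻ a` and `c ≻ a ≻ b ≻ d ≻ others`, where `c, a, b, d` are the
alternatives `0, 1, 2, 3`. -/
def pivotPair {m : ℕ} (hm : 4 ≤ m) : Ranking m × Ranking m :=
  ((Equiv.swap ⟨0, by omega⟩ ⟨1, by omega⟩).trans Fin.revPerm, 1)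

theorem pivotPair_fst_apply {m : ℕ} (hm : 4 ≤ m) (i : Fin m) :
    ((pivotPair hm).1 i : ℕ) =
      m - 1 - if (i : ℕ) = 0 then 1 else if (i : ℕ) = 1 then 0 else (i : ℕ) := by
  simp only [pivotPair, Equiv.trans_apply, Equiv.swap_apply_def, Fin.revPerm_apply, Fin.val_rev,
    Fin.ext_iff]
  split_ifs <;> first | omega | (simp only; omega)

theorem swapMargin_pivotPair {m : ℕ} (hm : 4 ≤ m) (i j : Fin m) :
    4 * antisymmetrize startMargin i j + 8 * swapMargin (pivotPair hm) i j =
      4 * antisymmetrize endMargin i j := by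
  have hsnd : ∀ i, (pivotPair hm).2 i = i := fun i => rfl
  simp only [swapMargin, voteMargin, Fin.lt_def, pivotPair_fst_apply, hsnd, antisymmetrize]
  obtain ⟨i, hi⟩ := i
  obtain ⟨j, hj⟩ := j
  rcases i with _ | _ | _ | _ | i <;> rcases j with _ | _ | _ | _ | j <;>
    simp [startMargin, endMargin] <;> split_ifs <;> omega

theorem pivotPair_fst_closed {m : ℕ} (hm : 4 ≤ m) (y w : Fin m) (hy : (y : ℕ) ≤ 1)
    (h : (pivotPair hm).1 y ≤ (pivotPair hm).1 w) : (w : ℕ) ≤ 1 := by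
  rw [Fin.le_def, pivotPair_fst_apply, pivotPair_fst_apply] at h
  have := w.2
  split_ifs at h <;> omega

/-- The displacements that occur in the argument: an optional complete run of `8 h` groups on the
pivotal pair, and then up to `17 h` groups on one pair. -/
def displacements {m : ℕ} (hm : 4 ≤ m) (h B : ℕ) : Finset (Ranking m × Ranking m → ℕ) :=
  (Finset.univ ×ˢ Finset.univ ×ˢ Finset.range (17 * h + 1)).image
    fun p : Bool × (Ranking m × Ranking m) × ℕ =>
      (if p.1 then Pi.single (pivotPair hm) (8 * h * B) else 0) + Pi.single p.2.1 (p.2.2 * B)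

theorem IsGrid.exists_displacement_not_cAndP {m n h B : ℕ} (hm : 4 ≤ m) (r : VotingRule m)
    {z : Fin n → Ranking m × Ranking m} {g : (Ranking m × Ranking m → ℕ) → Finset (Fin n)}
    (hg : IsGrid z g) {x : Ranking m × Ranking m → ℕ} (hB : 0 < B)
    (hx : ∀ k, x k + 25 * (h * B) ≤ classCount z Finset.univ k)
    (hM : ∀ i j, |wmg (coinProfile z (g x)) i j -
      4 * ((h * B : ℕ) : ℤ) * antisymmetrize startMargin i j| < 2 * ((h * B : ℕ) : ℤ)) :
    ∃ δ ∈ displacements hm h B, ¬ CAndP m r n (coinProfile z (g (x + δ))) B := by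
  by_contra! hgood
  have hgood1 : ∀ t ≤ 17 * h, ∀ k, ∀ j ≤ t,
      CAndP m r n (coinProfile z (g (x + Pi.single k (j * B)))) B := by
    intro t ht k j hj
    refine hgood _ (Finset.mem_image.2 ⟨(false, k, j), ?_, by simp⟩)
    simp only [Finset.mem_product, Finset.mem_univ, Finset.mem_range, true_and]
    omega
  set x' := x + Pi.single (pivotPair hm) (8 * h * B) with hx'
  have hgood2 : ∀ t ≤ 17 * h, ∀ k, ∀ j ≤ t,
      CAndP m r n (coinProfile z (g (x' + Pi.single k (j * B)))) B := by
    intro t ht k j hj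
    have := hgood (x' - x + Pi.single k (j * B))
      (Finset.mem_image.2 ⟨(true, k, j), ?_, by simp [hx']⟩)
    · rwa [← add_assoc, hx', add_tsub_cancel_left, ← hx'] at this
    simp only [Finset.mem_product, Finset.mem_univ, Finset.mem_range, true_and]
    omega
  set H : ℕ := h * B with hH
  have hHz : (0 : ℤ) < H := by
    have := (abs_nonneg _).trans_lt (hM ⟨0, by omega⟩ ⟨0, by omega⟩)
    linarith
  have hb1 : ∀ t ≤ 17, ∀ k, x k + t * h * B ≤ classCount z Finset.univ k := by
    intro t ht k
    have h1 := hx k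
    have h2 : t * h * B ≤ 17 * H := by rw [mul_assoc]; exact Nat.mul_le_mul_right _ ht
    omega
  have hx'le : ∀ k, x' k ≤ x k + 8 * H := by
    intro k
    rw [hx', Pi.add_apply]
    refine Nat.add_le_add_left ?_ _
    rcases eq_or_ne k (pivotPair hm) with rfl | hk
    · rw [Pi.single_eq_same, hH, mul_assoc]
    · rw [Pi.single_eq_of_ne hk]; exact Nat.zero_le _
  have hb2 : ∀ t ≤ 17, ∀ k, x' k + t * h * B ≤ classCount z Finset.univ k := by
    intro t ht k
    have h1 := hx k
    have h2 : t * h * B ≤ 17 * H := by rw [mul_assoc]; exact Nat.mul_le_mul_right _ ht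
    have h3 := hx'le k
    omega
  have hpiv : x' ≤ classCount z Finset.univ := fun k =>
    (hx'le k).trans (le_trans (by omega) (hx k))
  have hM' : ∀ i j, |wmg (coinProfile z (g x')) i j -
      4 * (H : ℤ) * antisymmetrize endMargin i j| < 2 * (H : ℤ) := by
    intro i j
    have h1 := hM i j
    rw [hx', hg.wmg_add_single hpiv]
    have h2 := swapMargin_pivotPair hm i j
    convert h1 using 2
    have h3 : ((8 * h * B : ℕ) : ℤ) = 8 * (H : ℤ) := by rw [hH, mul_assoc]; push_cast; ring
    rw [h3]
    linear_combination (H : ℤ) * h2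
  have hexcl : ∀ (f : ℕ → ℕ → ℤ) (w : Ranking m × Ranking m → ℕ) (t : ℕ), t ≤ 17 →
      (∀ k, w k + t * h * B ≤ classCount z Finset.univ k) →
      (∀ k, ∀ j ≤ t * h, CAndP m r n (coinProfile z (g (w + Pi.single k (j * B)))) B) →
      (∀ i j, |wmg (coinProfile z (g w)) i j - 4 * (H : ℤ) * antisymmetrize f i j| <
        2 * (H : ℤ)) →
      ∀ y y' : Fin m, y ≠ y' → (t : ℤ) + 1 ≤ 2 * antisymmetrize f y' y →
      (∀ c, c ≠ y → c ≠ y' → 1 ≤ 2 * antisymmetrize f y' c + t) →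
      r n (coinProfile z (g w)) ≠ y := by
    intro f w t ht hb hgd hest y y' hyy h1 h2
    have h3 : ((t * h * B : ℕ) : ℤ) = t * (H : ℤ) := by rw [hH, mul_assoc]; push_cast; ring
    refine hg.winner_ne_of_margins hB (t * h) hb hgd hyy ?_ fun c hc hc' => ?_
    · have := (abs_lt.1 (hest y' y)).1
      rw [h3]
      nlinarith [mul_le_mul_of_nonneg_left h1 hHz.le]
    · have := (abs_lt.1 (hest y' c)).1
      rw [h3]
      nlinarith [mul_le_mul_of_nonneg_left (h2 c hc hc') hHz.le]
  -- Exchanging `t * h` groups shifts margins by `2 * t * H`, which is `t / 2` units of `4 * H`. As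
  -- the margins have an error below half a unit, the shift has to be half-way between the unit
  -- margins of the excluding alternative: `t = 17` for `d` and `t = 15` for `a` with the margins at
  -- the start, and `t = 11` for `b` and `t = 13` for `c` with those at the end.
  have hstart : r n (coinProfile z (g x)) = ⟨1, by omega⟩ := by
    by_contra hne
    set y := r n (coinProfile z (g x)) with hy
    by_cases hbc : (y : ℕ) = 0 ∨ (y : ℕ) = 2
    · refine hexcl startMargin x 17 le_rfl (hb1 17 le_rfl) (hgood1 _ le_rfl) hM y
        ⟨3, by omega⟩ (fun h => by simp [h] at hbc) ?_ (fun c hc hc' => ?_) hy.symm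
      · rcases hbc with h | h <;> simp [antisymmetrize, Fin.lt_def, h, startMargin]
      · obtain ⟨c, hcm⟩ := c
        rcases c with _ | _ | _ | _ | c <;>
          simp [antisymmetrize, Fin.lt_def, startMargin] at hc' ⊢
    · refine hexcl startMargin x 15 (by norm_num) (hb1 15 (by norm_num))
        (hgood1 _ (by omega)) hM y ⟨1, by omega⟩ hne ?_ (fun c hc hc' => ?_) hy.symm
      · obtain ⟨y, hym⟩ := y
        rcases y with _ | _ | _ | _ | y <;>
          simp [antisymmetrize, Fin.lt_def, startMargin] at hne hbc ⊢
      · obtain ⟨c, hcm⟩ := c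
        rcases c with _ | _ | _ | _ | c <;>
          simp [antisymmetrize, Fin.lt_def, startMargin] at hc' ⊢
  have hmem := hg.winner_mem_of_chain (r := r) (L := {w : Fin m | (w : ℕ) ≤ 1})
    (k := pivotPair hm)
    (fun y hy w hw => pivotPair_fst_closed hm y w hy hw)
    (fun y (hy : (y : ℕ) ≤ 1) w (hw : w ≤ y) => show (w : ℕ) ≤ 1 from le_trans hw hy) hB (8 * h)
    hpiv
    (fun j hj => (hgood1 (8 * h) (by omega) _ j hj).2) (by rw [hstart]; exact le_refl 1)
  rw [← hx'] at hmem
  set y := r n (coinProfile z (g x')) with hy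
  obtain h0 | h1 : (y : ℕ) = 0 ∨ (y : ℕ) = 1 := by
    have : (y : ℕ) ≤ 1 := hmem
    omega
  · refine hexcl endMargin x' 11 (by norm_num) (hb2 11 (by norm_num)) (hgood2 _ (by omega)) hM' y
      ⟨2, by omega⟩ (fun h => by simp [h] at h0) ?_ (fun c hc hc' => ?_) hy.symm
    · simp [antisymmetrize, Fin.lt_def, h0, endMargin]
    · obtain ⟨c, hcm⟩ := c
      rcases c with _ | _ | _ | _ | c <;>
        simp [antisymmetrize, Fin.lt_def, endMargin] at hc' ⊢
  · refine hexcl endMargin x' 13 (by norm_num) (hb2 13 (by norm_num)) (hgood2 _ (by omega)) hM' y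
      ⟨0, by omega⟩ (fun h => by simp [h] at h1) ?_ (fun c hc hc' => ?_) hy.symm
    · simp [antisymmetrize, Fin.lt_def, h1, endMargin]
    · obtain ⟨c, hcm⟩ := c
      rcases c with _ | _ | _ | _ | c <;>
        simp [antisymmetrize, Fin.lt_def, endMargin] at hc' ⊢

/-! ### Averaging over permutations of the voters -/

/-- Adding the elements of `s` one at a time. -/
theorem exists_monotone_subsets {α : Type*} [DecidableEq α] (s : Finset α) :
    ∃ c : ℕ → Finset α, Monotone c ∧ (∀ x, c x ⊆ s) ∧ ∀ x ≤ s.card, (c x).card = x := by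
  refine ⟨fun x => (s.toList.take x).toFinset, fun x y hxy => ?_, fun x a ha => ?_, fun x hx => ?_⟩
  · intro a ha
    rw [List.mem_toFinset] at ha ⊢
    exact (List.take_subset_take_left _ hxy) ha
  · rw [List.mem_toFinset] at ha
    exact Finset.mem_toList.1 (List.mem_of_mem_take ha)
  · rw [List.toFinset_card_of_nodup ((s.nodup_toList).sublist (List.take_sublist _ _)),
      List.length_take, Finset.length_toList, min_eq_left hx]

theorem exists_isGrid {n : ℕ} {K : Type*} [DecidableEq K] (z : Fin n → K) :
    ∃ g : (K → ℕ) → Finset (Fin n), IsGrid z g := by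
  choose c hmono hsub hcard using fun k : K =>
    exists_monotone_subsets (Finset.univ.filter fun i => z i = k)
  refine ⟨fun x => Finset.univ.filter fun i => i ∈ c (z i) (x (z i)), ⟨fun x y hxy i hi => ?_,
    fun x hx k => ?_⟩⟩
  · simp only [Finset.mem_filter, Finset.mem_univ, true_and] at hi ⊢
    exact hmono _ (hxy _) hi
  · rw [← hcard k (x k) (hx k), classCount]
    congr 1
    ext i
    simp only [Finset.mem_filter, Finset.mem_univ, true_and]
    constructor
    · rintro ⟨h, rfl⟩; exact h
    · intro h
      have := (Finset.mem_filter.1 (hsub k _ h)).2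
      subst this
      exact ⟨h, rfl⟩

theorem classCount_map {n : ℕ} {K : Type*} [DecidableEq K] {z : Fin n → K}
    {σ : Equiv.Perm (Fin n)} (hσ : ∀ i, z (σ i) = z i) (A : Finset (Fin n)) (k : K) :
    classCount z (A.map σ.toEmbedding) k = classCount z A k := by
  rw [classCount, Finset.filter_map, Finset.card_map, classCount]
  congr 1
  ext i
  simp [hσ]

theorem IsGrid.map {n : ℕ} {K : Type*} [DecidableEq K] {z : Fin n → K}
    {g : (K → ℕ) → Finset (Fin n)} (hg : IsGrid z g) {σ : Equiv.Perm (Fin n)}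
    (hσ : ∀ i, z (σ i) = z i) : IsGrid z fun x => (g x).map σ.toEmbedding where
  mono _ _ hxy := Finset.map_subset_map.2 (hg.mono hxy)
  count x hx k := by rw [classCount_map hσ, hg.count x hx]

/-- Sets with the same class counts differ by a permutation that preserves the classes. -/
theorem exists_perm_map_eq {n : ℕ} {K : Type*} [DecidableEq K] {z : Fin n → K}
    {A A' : Finset (Fin n)} (h : ∀ k, classCount z A k = classCount z A' k) :
    ∃ τ : Equiv.Perm (Fin n), (∀ i, z (τ i) = z i) ∧ A.map τ.toEmbedding = A' := by
  have hcompl : ∀ k, (Aᶜ.filter fun i => z i = k).card = (A'ᶜ.filter fun i => z i = k).card := by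
    intro k
    have aux : ∀ A : Finset (Fin n), classCount z A k + (Aᶜ.filter fun i => z i = k).card =
        classCount z Finset.univ k := by
      intro A
      rw [classCount, classCount, ← Finset.card_union_of_disjoint, ← Finset.filter_union,
        Finset.union_compl]
      exact Finset.disjoint_filter_filter disjoint_compl_right
    have h1 := aux A
    have h2 := aux A'
    have h3 := h k
    omega
  have hfib : ∀ c : K × Bool, Nonempty ({i // (z i, decide (i ∈ A)) = c} ≃
      {i // (z i, decide (i ∈ A')) = c}) := by
    rintro ⟨k, b⟩
    refine Fintype.card_eq.1 ?_
    rw [Fintype.card_subtype, Fintype.card_subtype]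
    cases b with
    | true =>
      convert h k using 1 <;>
      · unfold classCount
        congr 1
        ext i
        simp [and_comm]
    | false =>
      convert hcompl k using 1 <;>
      · congr 1
        ext i
        simp [and_comm]
  let τ : Equiv.Perm (Fin n) := Equiv.ofFiberEquiv fun c => (hfib c).some
  have hτ : ∀ i, (z (τ i), decide (τ i ∈ A')) = (z i, decide (i ∈ A)) :=
    fun i => Equiv.ofFiberEquiv_map (fun c => (hfib c).some) i
  refine ⟨τ, fun i => congrArg Prod.fst (hτ i), ?_⟩
  have hmem : ∀ i, τ i ∈ A' ↔ i ∈ A := fun i => by simpa using congrArg Prod.snd (hτ i)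
  ext i
  rw [Finset.mem_map_equiv, ← hmem, Equiv.apply_symm_apply]

/-- A lower bound for the number of sets `A` with `p A` can be verified on grids: the sets `A` are
averaged over the permutations that preserve the classes, and each `A` is such a permutation of the
grid point with the same class counts. -/
theorem le_card_filter_of_forall_isGrid {n : ℕ} {K : Type*} [DecidableEq K] {z : Fin n → K}
    (p : Finset (Fin n) → Prop) [DecidablePred p] (c : ℕ)
    (h : ∀ g, IsGrid z g →
      c ≤ (Finset.univ.filter fun A : Finset (Fin n) => p (g (classCount z A))).card) :
    c ≤ (Finset.univ.filter fun A : Finset (Fin n) => p A).card := by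
  obtain ⟨g, hg⟩ := exists_isGrid z
  let G : Finset (Equiv.Perm (Fin n)) := Finset.univ.filter fun σ => ∀ i, z (σ i) = z i
  have hG : 0 < G.card := Finset.card_pos.2 ⟨1, by simp [G]⟩
  have hswap : ∀ f : Finset (Fin n) → Finset (Fin n),
      ∑ σ ∈ G, (Finset.univ.filter fun A => p ((f A).map σ.toEmbedding)).card =
        ∑ A, (G.filter fun σ => p ((f A).map σ.toEmbedding)).card := by
    intro f
    simp_rw [Finset.card_filter]
    exact Finset.sum_comm
  have h1 : ∀ σ : Equiv.Perm (Fin n),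
      (Finset.univ.filter fun A : Finset (Fin n) => p (A.map σ.toEmbedding)).card =
        (Finset.univ.filter fun A : Finset (Fin n) => p A).card := by
    intro σ
    refine Finset.card_bijective (Equiv.finsetCongr σ) (Equiv.bijective _) fun A => ?_
    simp [Equiv.finsetCongr_apply]
  have h2 : ∀ A : Finset (Fin n), (G.filter fun σ => p (A.map σ.toEmbedding)).card =
      (G.filter fun σ => p ((g (classCount z A)).map σ.toEmbedding)).card := by
    intro A
    obtain ⟨τ, hτ, hτA⟩ := exists_perm_map_eq (z := z) (A := A) (A' := g (classCount z A))
      fun k => (hg.count _ (fun k => Finset.card_le_card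
        (Finset.filter_subset_filter _ (Finset.subset_univ _))) k).symm
    have hτ' : ∀ i, z (τ.symm i) = z i := fun i => by
      have := hτ (τ.symm i)
      rw [Equiv.apply_symm_apply] at this
      exact this.symm
    refine Finset.card_bij (fun σ _ => σ * τ⁻¹) ?_ (fun _ _ _ _ h => mul_right_cancel h) ?_
    · intro σ hσ
      simp only [G, Finset.mem_filter, Finset.mem_univ, true_and] at hσ ⊢
      refine ⟨fun i => (hσ.1 _).trans (hτ' i), ?_⟩
      rw [← hτA, Finset.map_map]
      convert hσ.2 using 2
      ext i
      simp
    · intro σ hσ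
      simp only [G, Finset.mem_filter, Finset.mem_univ, true_and] at hσ
      refine ⟨σ * τ, ?_, by simp⟩
      simp only [G, Finset.mem_filter, Finset.mem_univ, true_and]
      refine ⟨fun i => (hσ.1 _).trans (hτ i), ?_⟩
      have := hσ.2
      rw [← hτA, Finset.map_map] at this
      convert this using 2
      rfl
  refine Nat.le_of_mul_le_mul_left ?_ hG
  calc G.card * c = ∑ _σ ∈ G, c := by rw [Finset.sum_const, smul_eq_mul]
    _ ≤ ∑ σ ∈ G, (Finset.univ.filter fun A : Finset (Fin n) =>
          p ((g (classCount z A)).map σ.toEmbedding)).card :=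
        Finset.sum_le_sum fun σ hσ => h _ (hg.map (Finset.mem_filter.1 hσ).2)
    _ = ∑ σ ∈ G, (Finset.univ.filter fun A : Finset (Fin n) => p (A.map σ.toEmbedding)).card := by
        rw [hswap fun A => g (classCount z A), hswap fun A => A]
        exact Finset.sum_congr rfl fun A _ => (h2 A).symm
    _ = _ := by rw [Finset.sum_congr rfl fun σ _ => h1 σ, Finset.sum_const, smul_eq_mul]

theorem prod_choose_le_card_classCount_eq {n : ℕ} {K : Type*} [Fintype K] [DecidableEq K]
    (z : Fin n → K) (x : K → ℕ) :
    ∏ k, (classCount z Finset.univ k).choose (x k) ≤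
      (Finset.univ.filter fun A : Finset (Fin n) => classCount z A = x).card := by
  have hcard : (Fintype.piFinset fun k => Finset.powersetCard (x k)
      (Finset.univ.filter fun i => z i = k)).card =
      ∏ k, (classCount z Finset.univ k).choose (x k) := by
    rw [Fintype.card_piFinset]
    exact Finset.prod_congr rfl fun k _ => Finset.card_powersetCard _ _
  rw [← hcard]
  have hfil : ∀ a ∈ Fintype.piFinset (fun k => Finset.powersetCard (x k)
      (Finset.univ.filter fun i => z i = k)), ∀ k,
      ((Finset.univ.biUnion a).filter fun i => z i = k) = a k := by
    intro a ha k
    have hsub : ∀ l, ∀ i ∈ a l, z i = l := fun l i hi => (Finset.mem_filter.1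
      ((Finset.mem_powersetCard.1 (Fintype.mem_piFinset.1 ha l)).1 hi)).2
    ext i
    simp only [Finset.mem_filter, Finset.mem_biUnion, Finset.mem_univ, true_and]
    constructor
    · rintro ⟨⟨l, hl⟩, rfl⟩
      rwa [hsub l i hl]
    · exact fun h => ⟨⟨k, h⟩, hsub k i h⟩
  refine Finset.card_le_card_of_injOn (fun a => Finset.univ.biUnion a) ?_ ?_
  · intro a ha
    rw [Finset.mem_coe] at ha
    simp only [Finset.coe_filter, Finset.mem_univ, true_and, Set.mem_ofPred_eq]
    funext k
    rw [classCount, hfil a ha k]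
    exact (Finset.mem_powersetCard.1 (Fintype.mem_piFinset.1 ha k)).2
  · intro a ha a' ha' h
    funext k
    rw [← hfil a ha k, ← hfil a' ha' k]
    simp only at h
    rw [h]

theorem sum_classCount {n : ℕ} {K : Type*} [Fintype K] [DecidableEq K] (z : Fin n → K) :
    ∑ k, classCount z Finset.univ k = n := by
  have := Finset.card_eq_sum_card_fiberwise (f := z) (s := (Finset.univ : Finset (Fin n)))
    (t := Finset.univ) (fun _ _ => Finset.mem_univ _)
  rw [Finset.card_univ, Fintype.card_fin] at this
  exact this.symm

/-! ### Second moments -/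

/-- The variance of a sum of independent uniform draws, cleared of denominators. -/
theorem sum_sq_sum_apply {K : Type*} [Fintype K] (f : K → ℝ) (hf : ∑ k, f k = 0) (n : ℕ) :
    ∑ z : Fin n → K, (∑ i, f (z i)) ^ 2 * (Fintype.card K : ℝ) =
      n * (Fintype.card K : ℝ) ^ n * ∑ k, f k ^ 2 := by
  induction n with
  | zero => simp
  | succ n ih =>
    rw [← (Fin.consEquiv fun _ : Fin (n + 1) => K).sum_comp, Fintype.sum_prod_type]
    simp only [Fin.consEquiv_apply, Fin.sum_univ_succ, Fin.cons_zero, Fin.cons_succ]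
    have h : ∀ (a : K) (z : Fin n → K), (f a + ∑ i, f (z i)) ^ 2 * (Fintype.card K : ℝ) =
        f a ^ 2 * Fintype.card K + f a * (2 * (∑ i, f (z i)) * Fintype.card K) +
          (∑ i, f (z i)) ^ 2 * Fintype.card K := fun a z => by ring
    simp_rw [h, Finset.sum_add_distrib, ← Finset.mul_sum, ih, ← Finset.sum_mul, hf]
    simp only [Finset.sum_const, Finset.card_univ, Fintype.card_fun, Fintype.card_fin,
      nsmul_eq_mul, ← Finset.mul_sum]
    push_cast
    ring

/-- Chebyshev's inequality for a sum of independent uniform draws from `K`, as a count. -/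
theorem card_le_abs_sum_mul_sq_le {K : Type*} [Fintype K] [Nonempty K] (f : K → ℝ)
    (hf : ∑ k, f k = 0)
    (hf1 : ∀ k, |f k| ≤ 1) (n : ℕ) {l : ℝ} (hl : 0 ≤ l) :
    ((Finset.univ.filter fun z : Fin n → K => l ≤ |∑ i, f (z i)|).card : ℝ) * l ^ 2 ≤
      n * (Fintype.card K : ℝ) ^ n := by
  have hq : (0 : ℝ) < Fintype.card K := by exact_mod_cast Fintype.card_pos
  have h1 : ∑ k, f k ^ 2 ≤ Fintype.card K := by
    calc ∑ k, f k ^ 2 ≤ ∑ _k : K, (1 : ℝ) :=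
          Finset.sum_le_sum fun k _ => (sq_le_one_iff_abs_le_one _).2 (hf1 k)
      _ = _ := by simp
  have h2 := sum_sq_sum_apply f hf n
  rw [← Finset.sum_mul] at h2
  have h3 : ((Finset.univ.filter fun z : Fin n → K => l ≤ |∑ i, f (z i)|).card : ℝ) * l ^ 2 ≤
      ∑ z : Fin n → K, (∑ i, f (z i)) ^ 2 := by
    rw [← nsmul_eq_mul]
    refine (Finset.card_nsmul_le_sum _ (fun z : Fin n → K => (∑ i, f (z i)) ^ 2) _ ?_).trans
      (Finset.sum_le_sum_of_subset_of_nonneg (Finset.subset_univ _) fun _ _ _ => sq_nonneg _)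
    intro z hz
    rw [← sq_abs (∑ i, f (z i))]
    exact pow_le_pow_left₀ hl (Finset.mem_filter.1 hz).2 2
  refine le_of_mul_le_mul_right ?_ hq
  calc _ ≤ (∑ z : Fin n → K, (∑ i, f (z i)) ^ 2) * Fintype.card K :=
        mul_le_mul_of_nonneg_right h3 hq.le
    _ = n * (Fintype.card K : ℝ) ^ n * ∑ k, f k ^ 2 := h2
    _ ≤ _ := mul_le_mul_of_nonneg_left h1 (by positivity)

/-! ### Binomial coefficients near the centre -/

theorem sixteen_pow_le_centralBinom_sq (n : ℕ) (hn : 0 < n) :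
    16 ^ n ≤ 4 * n * n.centralBinom ^ 2 := by
  induction n, hn using Nat.le_induction with
  | base => simp [Nat.centralBinom, Nat.choose]
  | succ n hn ih =>
    have h := Nat.succ_mul_centralBinom_succ n
    refine Nat.le_of_mul_le_mul_right (c := n + 1) ?_ n.succ_pos
    calc 16 ^ (n + 1) * (n + 1) = 16 * (n + 1) * 16 ^ n := by ring
      _ ≤ 16 * (n + 1) * (4 * n * n.centralBinom ^ 2) := Nat.mul_le_mul_left _ ih
      _ = (16 * (4 * n * (n + 1))) * n.centralBinom ^ 2 := by ring
      _ ≤ (16 * (2 * n + 1) ^ 2) * n.centralBinom ^ 2 :=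
          Nat.mul_le_mul_right _ (by nlinarith)
      _ = 4 * (2 * (2 * n + 1) * n.centralBinom) ^ 2 := by ring
      _ = 4 * ((n + 1) * (n + 1).centralBinom) ^ 2 := by rw [h]
      _ = 4 * (n + 1) * (n + 1).centralBinom ^ 2 * (n + 1) := by ring

theorem four_pow_le_choose_half_sq (n : ℕ) : 4 ^ n ≤ 2 * (n + 1) * n.choose (n / 2) ^ 2 := by
  rcases Nat.even_or_odd' n with ⟨k, rfl | rfl⟩
  · rcases Nat.eq_zero_or_pos k with rfl | hk
    · simp
    have h := sixteen_pow_le_centralBinom_sq k hk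
    rw [Nat.mul_div_cancel_left _ two_pos, pow_mul, ← Nat.centralBinom_eq_two_mul_choose]
    norm_num
    refine h.trans (Nat.mul_le_mul_right _ (by omega))
  · have h := sixteen_pow_le_centralBinom_sq (k + 1) k.succ_pos
    have hc : (k + 1).centralBinom = 2 * (2 * k + 1).choose k := by
      rw [Nat.centralBinom_eq_two_mul_choose, show 2 * (k + 1) = (2 * k + 1) + 1 by ring,
        Nat.choose_succ_succ, Nat.choose_symm_half]
      ring
    rw [hc] at h
    rw [show (2 * k + 1) / 2 = k by omega]
    have h4 : (4 : ℕ) ^ (2 * k + 1) * 4 = 16 ^ (k + 1) := by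
      rw [← pow_succ, show 2 * k + 1 + 1 = 2 * (k + 1) by ring, pow_mul]
      norm_num
    nlinarith

/-- Within distance `t` of the centre, each step away from it costs at most a factor
`exp (4 (2 t + 1) / n)`. -/
theorem choose_half_le_choose_mul_exp {n : ℕ} (a : ℕ) {t : ℕ} (ht : 4 * t ≤ n) (hat : a ≤ t) :
    (n.choose (n / 2) : ℝ) ≤ n.choose (n / 2 + a) * Real.exp (a * (4 * (2 * t + 1) / n)) := by
  induction a with
  | zero => simp
  | succ a ih =>
    have ih' := ih (by omega)
    have hn : (0 : ℝ) < n := by exact_mod_cast (by omega : 0 < n)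
    have hle : n / 2 + a ≤ n := by omega
    have hrec := Nat.choose_succ_right_eq n (n / 2 + a)
    have hrec' : (n.choose (n / 2 + a + 1) : ℝ) * ((n / 2 : ℕ) + a + 1) =
        n.choose (n / 2 + a) * (n - ((n / 2 : ℕ) + a)) := by
      have := congrArg (Nat.cast : ℕ → ℝ) hrec
      push_cast [Nat.cast_sub hle] at this
      exact this
    have hhalf : (2 * (n / 2 : ℕ) : ℝ) ≤ n := by exact_mod_cast Nat.mul_div_le n 2
    have hat' : (a : ℝ) + 1 ≤ t := by exact_mod_cast hat
    have ht' : (4 * t : ℝ) ≤ n := by exact_mod_cast ht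
    have hden : (n : ℝ) / 4 ≤ n - ((n / 2 : ℕ) + a) := by linarith
    have hden0 : (0 : ℝ) < n - ((n / 2 : ℕ) + a) := by linarith [hn]
    have hratio : ((n / 2 : ℕ) + a + 1 : ℝ) ≤
        (n - ((n / 2 : ℕ) + a)) * Real.exp (4 * (2 * t + 1) / n) := by
      have h1 : (4 * (2 * t + 1) / n : ℝ) + 1 ≤ Real.exp (4 * (2 * t + 1) / n) :=
        Real.add_one_le_exp _
      have h2 : (2 * t + 1 : ℝ) ≤ (n - ((n / 2 : ℕ) + a)) * (4 * (2 * t + 1) / n) := by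
        calc (2 * t + 1 : ℝ) = n / 4 * (4 * (2 * t + 1) / n) := by field_simp
          _ ≤ _ := mul_le_mul_of_nonneg_right hden (by positivity)
      have h3 := mul_le_mul_of_nonneg_left h1 hden0.le
      nlinarith
    refine ih'.trans ?_
    have hsplit : Real.exp ((a + 1 : ℕ) * (4 * (2 * t + 1) / n)) =
        Real.exp (4 * (2 * t + 1) / n) * Real.exp (a * (4 * (2 * t + 1) / n)) := by
      rw [← Real.exp_add]; congr 1; push_cast; ring
    rw [hsplit, ← mul_assoc]
    refine mul_le_mul_of_nonneg_right ?_ (Real.exp_pos _).le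
    refine le_of_mul_le_mul_right ?_ hden0
    calc (n.choose (n / 2 + a) : ℝ) * (n - ((n / 2 : ℕ) + a))
        = n.choose (n / 2 + a + 1) * ((n / 2 : ℕ) + a + 1) := hrec'.symm
      _ ≤ n.choose (n / 2 + a + 1) *
          ((n - ((n / 2 : ℕ) + a)) * Real.exp (4 * (2 * t + 1) / n)) :=
          mul_le_mul_of_nonneg_left hratio (Nat.cast_nonneg _)
      _ = _ := by rw [← add_assoc]; ring

/-- A binomial coefficient at distance `O(√n)` from the centre is at least a constant times
`2 ^ n / √n`. -/
theorem two_pow_le_choose_mul {n x t : ℕ} (ht : 4 * t ≤ n) (h1 : n ≤ 2 * x + 2 * t)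
    (h2 : 2 * x ≤ n + 2 * t) (ht1 : 1 ≤ t) :
    (2 : ℝ) ^ n ≤ n.choose x * (2 * Real.sqrt n * Real.exp (16 * t ^ 2 / n)) := by
  have key : ∀ y : ℕ, n ≤ 2 * y → 2 * y ≤ n + 2 * t →
      (2 : ℝ) ^ n ≤ n.choose y * (2 * Real.sqrt n * Real.exp (16 * t ^ 2 / n)) := by
    intro y hy hy'
    have hn : (1 : ℝ) ≤ n := by exact_mod_cast (by omega : 1 ≤ n)
    have hcen : (2 : ℝ) ^ n ≤ 2 * Real.sqrt n * n.choose (n / 2) := by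
      refine le_of_sq_le_sq ?_ (by positivity)
      have h : (4 : ℝ) ^ n ≤ 2 * (n + 1) * (n.choose (n / 2) : ℝ) ^ 2 := by
        exact_mod_cast four_pow_le_choose_half_sq n
      calc ((2 : ℝ) ^ n) ^ 2 = 4 ^ n := by rw [← pow_mul, mul_comm, pow_mul]; norm_num
        _ ≤ 2 * (n + 1) * (n.choose (n / 2) : ℝ) ^ 2 := h
        _ ≤ (4 * n) * (n.choose (n / 2) : ℝ) ^ 2 :=
            mul_le_mul_of_nonneg_right (by linarith) (by positivity)
        _ = (2 * Real.sqrt n * n.choose (n / 2)) ^ 2 := by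
            rw [mul_pow, mul_pow, Real.sq_sqrt (by linarith)]; norm_num
    obtain ⟨a, rfl⟩ : ∃ a, y = n / 2 + a := ⟨y - n / 2, by omega⟩
    have hat : a ≤ t := by omega
    have hstep := choose_half_le_choose_mul_exp a ht hat
    have hexp : (a * (4 * (2 * t + 1) / n) : ℝ) ≤ 16 * t ^ 2 / n := by
      rw [← mul_div_assoc]
      refine div_le_div_of_nonneg_right ?_ (by linarith)
      have h1 : (a : ℝ) ≤ t := by exact_mod_cast hat
      have h2 : (1 : ℝ) ≤ t := by exact_mod_cast ht1
      have h3 : (a : ℝ) * (4 * (2 * t + 1)) ≤ t * (4 * (2 * t + 1)) :=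
        mul_le_mul_of_nonneg_right h1 (by positivity)
      nlinarith
    calc (2 : ℝ) ^ n ≤ 2 * Real.sqrt n * n.choose (n / 2) := hcen
      _ ≤ 2 * Real.sqrt n * (n.choose (n / 2 + a) * Real.exp (16 * t ^ 2 / n)) := by
          refine mul_le_mul_of_nonneg_left (hstep.trans ?_) (by positivity)
          exact mul_le_mul_of_nonneg_left (Real.exp_le_exp.2 hexp) (Nat.cast_nonneg _)
      _ = _ := by ring
  rcases le_total n (2 * x) with h | h
  · exact key x h h2
  · rw [← Nat.choose_symm (show x ≤ n by omega)]
    exact key (n - x) (by omega) (by omega)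

/-! ### Counting violations for a fixed assignment of pairs -/

theorem card_displacements_le {m : ℕ} (hm : 4 ≤ m) (h B : ℕ) :
    (displacements hm h B).card ≤
      2 * (Fintype.card (Ranking m × Ranking m) * (17 * h + 1)) := by
  refine Finset.card_image_le.trans ?_
  simp [Finset.card_product]

theorem apply_le_of_mem_displacements {m : ℕ} {hm : 4 ≤ m} {h B : ℕ}
    {δ : Ranking m × Ranking m → ℕ} (hδ : δ ∈ displacements hm h B) (k : Ranking m × Ranking m) :
    δ k ≤ 25 * (h * B) := by
  obtain ⟨⟨b, l, j⟩, hp, rfl⟩ := Finset.mem_image.1 hδ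
  simp only [Finset.mem_product, Finset.mem_univ, Finset.mem_range, true_and] at hp
  have hs : ∀ (l : Ranking m × Ranking m) (a : ℕ), (Pi.single l a : _ → ℕ) k ≤ a := by
    intro l a
    rcases eq_or_ne k l with rfl | hk
    · rw [Pi.single_eq_same]
    · rw [Pi.single_eq_of_ne hk]; exact Nat.zero_le _
  have h1 : (if b then (Pi.single (pivotPair hm) (8 * h * B) : _ → ℕ) else 0) k ≤ 8 * h * B := by
    split_ifs
    · exact hs _ _
    · exact Nat.zero_le _
  have h2 := hs l (j * B)
  have h3 : j * B ≤ 17 * h * B := Nat.mul_le_mul_right _ (by omega)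
  rw [Pi.add_apply]
  calc _ ≤ 8 * h * B + 17 * h * B := Nat.add_le_add h1 (h2.trans h3)
    _ = _ := by ring

open Classical in
/-- Every starting point in a cube leads to a violation by one of few displacements, so violations
are a fraction of order `1 / h` of the cube. -/
theorem IsGrid.pow_le_card_displacements_mul {m n h B l : ℕ} (hm : 4 ≤ m) (r : VotingRule m)
    {z : Fin n → Ranking m × Ranking m} {g : (Ranking m × Ranking m → ℕ) → Finset (Fin n)}
    (hg : IsGrid z g) (c : Ranking m × Ranking m → ℕ) (hB : 0 < B)
    (hx : ∀ x : Ranking m × Ranking m → ℕ, (∀ k, c k ≤ x k ∧ x k < c k + l) →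
      ∀ k, x k + 25 * (h * B) ≤ classCount z Finset.univ k)
    (hM : ∀ x : Ranking m × Ranking m → ℕ, (∀ k, c k ≤ x k ∧ x k < c k + l) →
      ∀ i j, |wmg (coinProfile z (g x)) i j -
        4 * ((h * B : ℕ) : ℤ) * antisymmetrize startMargin i j| < 2 * ((h * B : ℕ) : ℤ)) :
    l ^ Fintype.card (Ranking m × Ranking m) ≤
      (displacements hm h B).card *
        ((Fintype.piFinset fun k => Finset.Ico (c k) (c k + l + 25 * (h * B))).filter fun y =>
          ¬ CAndP m r n (coinProfile z (g y)) B).card := by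
  have hU : (Fintype.piFinset fun k => Finset.Ico (c k) (c k + l)).card =
      l ^ Fintype.card (Ranking m × Ranking m) := by
    simp [Fintype.card_piFinset]
  have hmem : ∀ x ∈ Fintype.piFinset (fun k => Finset.Ico (c k) (c k + l)),
      ∀ k, c k ≤ x k ∧ x k < c k + l := fun x hx k => by
    have := Fintype.mem_piFinset.1 hx k
    rwa [Finset.mem_Ico] at this
  have hex : ∀ x : Ranking m × Ranking m → ℕ, ∃ δ,
      x ∈ Fintype.piFinset (fun k => Finset.Ico (c k) (c k + l)) →
      δ ∈ displacements hm h B ∧ ¬ CAndP m r n (coinProfile z (g (x + δ))) B := by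
    intro x
    by_cases hxU : x ∈ Fintype.piFinset (fun k => Finset.Ico (c k) (c k + l))
    · obtain ⟨δ, h1, h2⟩ := hg.exists_displacement_not_cAndP hm r hB (hx x (hmem x hxU))
        (hM x (hmem x hxU))
      exact ⟨δ, fun _ => ⟨h1, h2⟩⟩
    · exact ⟨0, fun h => absurd h hxU⟩
  choose δ hδ using hex
  rw [← hU, ← Finset.card_product]
  refine Finset.card_le_card_of_injOn (fun x => (δ x, x + δ x)) ?_ ?_
  · intro x hxU
    rw [Finset.mem_coe] at hxU
    rw [Finset.mem_coe, Finset.mem_product, Finset.mem_filter, Fintype.mem_piFinset]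
    refine ⟨(hδ x hxU).1, fun k => ?_, (hδ x hxU).2⟩
    have h1 := hmem x hxU k
    have h2 := apply_le_of_mem_displacements (hδ x hxU).1 k
    have h3 : (x + δ x) k = x k + δ x k := rfl
    refine Finset.mem_Ico.2 ?_
    dsimp only
    omega
  · intro x _ y _ hxy
    have h1 := (Prod.ext_iff.1 hxy).1
    have h2 := (Prod.ext_iff.1 hxy).2
    simp only at h1 h2
    rw [h1] at h2
    exact add_right_cancel h2

theorem card_mul_le_card_classCount {n : ℕ} {K : Type*} [Fintype K] [DecidableEq K]
    (z : Fin n → K) (q : (K → ℕ) → Prop) [DecidablePred q] (V : Finset (K → ℕ)) (hV : ∀ y ∈ V, q y)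
    {W : ℝ}
    (hW : ∀ y ∈ V, W ≤ ∏ k, ((classCount z Finset.univ k).choose (y k) : ℝ)) :
    V.card * W ≤
      ((Finset.univ.filter fun A : Finset (Fin n) => q (classCount z A)).card : ℝ) := by
  have h1 : ∑ y ∈ V, (Finset.univ.filter fun A : Finset (Fin n) => classCount z A = y).card ≤
      (Finset.univ.filter fun A : Finset (Fin n) => q (classCount z A)).card := by
    rw [← Finset.card_biUnion]
    · refine Finset.card_le_card fun A hA => ?_
      obtain ⟨y, hy, hAy⟩ := Finset.mem_biUnion.1 hA
      have := (Finset.mem_filter.1 hAy).2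
      refine Finset.mem_filter.2 ⟨Finset.mem_univ _, ?_⟩
      rw [this]
      exact hV y hy
    · intro y _ y' _ hyy
      refine Finset.disjoint_filter.2 fun A _ h h' => hyy (h.symm.trans h')
  have h2 : ∀ y ∈ V, W ≤
      ((Finset.univ.filter fun A : Finset (Fin n) => classCount z A = y).card : ℝ) := by
    intro y hy
    refine (hW y hy).trans ?_
    exact_mod_cast prod_choose_le_card_classCount_eq z y
  calc (V.card : ℝ) * W = ∑ _y ∈ V, W := by rw [Finset.sum_const, nsmul_eq_mul]
    _ ≤ ∑ y ∈ V, ((Finset.univ.filter fun A : Finset (Fin n) =>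
          classCount z A = y).card : ℝ) := Finset.sum_le_sum h2
    _ ≤ _ := by exact_mod_cast h1

/-- The weight on `i → j` when every voter's vote is replaced by the average of its two
possible votes. -/
noncomputable def meanMargin {m n : ℕ} (z : Fin n → Ranking m × Ranking m) (i j : Fin m) : ℝ :=
  ∑ v, ((voteMargin (z v).1 i j + voteMargin (z v).2 i j : ℤ) : ℝ) / 2

theorem IsGrid.wmg_eq_meanMargin_add {m n : ℕ} {z : Fin n → Ranking m × Ranking m}
    {g : (Ranking m × Ranking m → ℕ) → Finset (Fin n)} (hg : IsGrid z g)
    {x : Ranking m × Ranking m → ℕ} (hx : x ≤ classCount z Finset.univ) (i j : Fin m) :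
    (wmg (coinProfile z (g x)) i j : ℝ) = meanMargin z i j +
      ∑ k, ((x k : ℝ) - classCount z Finset.univ k / 2) * swapMargin k i j := by
  have h1 : meanMargin z i j = ∑ v, ((voteMargin (z v).1 i j : ℤ) : ℝ) +
      ∑ v, ((swapMargin (z v) i j : ℤ) : ℝ) / 2 := by
    rw [← Finset.sum_add_distrib]
    refine Finset.sum_congr rfl fun v _ => ?_
    unfold swapMargin
    push_cast
    ring
  have h2 : ∑ v, ((swapMargin (z v) i j : ℤ) : ℝ) / 2 =
      ∑ k, (classCount z Finset.univ k : ℝ) / 2 * swapMargin k i j := by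
    rw [← Finset.sum_fiberwise_of_maps_to (g := z) (t := Finset.univ)
      (fun _ _ => Finset.mem_univ _)]
    refine Finset.sum_congr rfl fun k _ => ?_
    rw [Finset.sum_congr rfl (g := fun _ => (swapMargin k i j : ℝ) / 2)]
    · rw [Finset.sum_const, nsmul_eq_mul]
      unfold classCount
      ring
    · intro v hv
      rw [(Finset.mem_filter.1 hv).2]
  rw [h1, h2, wmg_coinProfile]
  simp_rw [hg.count x hx, sub_mul, Finset.sum_sub_distrib]
  push_cast
  ring

theorem abs_swapMargin_le {m : ℕ} (k : Ranking m × Ranking m) (i j : Fin m) :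
    |swapMargin k i j| ≤ 2 := by
  have h1 := abs_le.1 (abs_voteMargin_le k.1 i j)
  have h2 := abs_le.1 (abs_voteMargin_le k.2 i j)
  unfold swapMargin
  exact abs_le.2 ⟨by linarith, by linarith⟩

/-- The elementary pairs span the antisymmetric matrices, with controlled coefficients. -/
theorem exists_sum_swapMargin_eq {m : ℕ} (v : Fin m → Fin m → ℝ) (hv : ∀ i j, v j i = - v i j)
    {b : ℝ} (hb : ∀ i j, |v i j| ≤ b) :
    ∃ w : Ranking m × Ranking m → ℝ, (∀ k, |w k| ≤ m ^ 2 * (b / 4)) ∧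
      ∀ i j, ∑ k, w k * swapMargin k i j = v i j := by
  have hex : ∀ i j : Fin m, ∃ k : Ranking m × Ranking m, i ≠ j → ∀ a b, swapMargin k a b =
      (if a = i ∧ b = j then 2 else 0) - (if a = j ∧ b = i then 2 else 0) := by
    intro i j
    by_cases hij : i = j
    · exact ⟨1, fun h => absurd hij h⟩
    · obtain ⟨k, hk⟩ := exists_elementary_pair hij
      exact ⟨k, fun _ => hk⟩
  choose e he using hex
  have hvd : ∀ i, v i i = 0 := fun i => by linarith [hv i i]
  refine ⟨fun k => ∑ i, ∑ j, if e i j = k then v i j / 4 else 0, fun k => ?_, fun a b => ?_⟩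
  · refine (Finset.abs_sum_le_sum_abs _ _).trans ?_
    calc ∑ i, |∑ j, if e i j = k then v i j / 4 else 0| ≤ ∑ _i : Fin m, ∑ _j : Fin m, b / 4 := by
          refine Finset.sum_le_sum fun i _ => (Finset.abs_sum_le_sum_abs _ _).trans ?_
          refine Finset.sum_le_sum fun j _ => ?_
          have h0 := (abs_nonneg _).trans (hb i j)
          split_ifs
          · rw [abs_div, abs_of_pos (by norm_num : (0 : ℝ) < 4)]
            exact div_le_div_of_nonneg_right (hb i j) (by norm_num)
          · simpa using by linarith
      _ = _ := by simp; ring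
  · have h1 : ∀ i j, v i j / 4 * (swapMargin (e i j) a b : ℝ) =
        (if i = a then if j = b then v i j / 2 else 0 else 0) -
          (if i = b then if j = a then v i j / 2 else 0 else 0) := by
      intro i j
      by_cases hij : i = j
      · subst hij; simp [hvd]
      · have e1 : (a = i ∧ b = j) ↔ (i = a ∧ j = b) := by simp only [eq_comm]
        have e2 : (a = j ∧ b = i) ↔ (i = b ∧ j = a) := by rw [and_comm]; simp only [eq_comm]
        rw [he i j hij, ← ite_and, ← ite_and]
        simp only [e1, e2]
        push_cast
        split_ifs <;> ring
    calc _ = ∑ i, ∑ j, v i j / 4 * (swapMargin (e i j) a b : ℝ) := by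
          simp_rw [Finset.sum_mul]
          rw [Finset.sum_comm]
          refine Finset.sum_congr rfl fun i _ => ?_
          rw [Finset.sum_comm]
          refine Finset.sum_congr rfl fun j _ => ?_
          simp [ite_mul]
      _ = v a b / 2 - v b a / 2 := by
          simp_rw [h1, Finset.sum_sub_distrib]
          simp
      _ = v a b := by rw [hv a b]; ring

theorem antisymmetrize_swap {m : ℕ} (f : ℕ → ℕ → ℤ) (i j : Fin m) :
    (antisymmetrize f j i : ℤ) = - antisymmetrize f i j := by
  unfold antisymmetrize
  rcases lt_trichotomy i j with h | h | h
  · simp [h, h.not_gt]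
  · simp [h]
  · simp [h, h.not_gt]

theorem abs_antisymmetrize_startMargin_le {m : ℕ} (i j : Fin m) :
    |antisymmetrize startMargin i j| ≤ 20 := by
  have h : ∀ i j, |startMargin i j| ≤ 20 := by
    intro i j
    unfold startMargin
    split <;> norm_num
  unfold antisymmetrize
  split_ifs
  · exact h _ _
  · rw [abs_neg]; exact h _ _
  · norm_num

theorem meanMargin_swap {m n : ℕ} (z : Fin n → Ranking m × Ranking m) (i j : Fin m) :
    meanMargin z j i = - meanMargin z i j := by
  unfold meanMargin
  rw [← Finset.sum_neg_distrib]
  refine Finset.sum_congr rfl fun v _ => ?_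
  rw [voteMargin_swap _ i j, voteMargin_swap _ i j]
  push_cast
  ring

theorem two_pow_div_le_choose {n N y C H T : ℕ} (hNn : N ≤ n) (hHn : (H : ℝ) ≤ Real.sqrt n)
    (hN : (n : ℝ) ≤ 2 * T * N) (hH : 1 ≤ H) (hCN : 4 * ((C + 27) * H) ≤ N)
    (h1 : N ≤ 2 * y + 2 * ((C + 27) * H)) (h2 : 2 * y ≤ N + 2 * ((C + 27) * H)) :
    (2 : ℝ) ^ N / (2 * Real.exp (32 * T * (C + 27) ^ 2) * Real.sqrt n) ≤ N.choose y := by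
  have htpos : 0 < (C + 27) * H := Nat.mul_pos (by omega) hH
  have hNk : (0 : ℝ) < N := by exact_mod_cast (by omega : 0 < N)
  have hn : (0 : ℝ) < n := hNk.trans_le (by exact_mod_cast hNn)
  have h4 := two_pow_le_choose_mul hCN h1 h2 htpos
  have hs : 0 < Real.sqrt n := Real.sqrt_pos.2 hn
  rw [div_le_iff₀ (by positivity)]
  refine h4.trans (mul_le_mul_of_nonneg_left ?_ (Nat.cast_nonneg _))
  have h5 : Real.sqrt N ≤ Real.sqrt n := Real.sqrt_le_sqrt (by exact_mod_cast hNn)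
  have h6 : Real.exp (16 * (((C + 27) * H : ℕ) : ℝ) ^ 2 / N) ≤
      Real.exp (32 * T * (C + 27) ^ 2) := by
    refine Real.exp_le_exp.2 ?_
    rw [div_le_iff₀ hNk]
    push_cast
    have h7 : (H : ℝ) ^ 2 ≤ n := by
      have := pow_le_pow_left₀ (Nat.cast_nonneg H) hHn 2
      rwa [Real.sq_sqrt hn.le] at this
    have h9 := mul_le_mul_of_nonneg_left (h7.trans hN)
      (by positivity : (0 : ℝ) ≤ 16 * (C + 27) ^ 2)
    linarith
  calc 2 * Real.sqrt N * Real.exp (16 * (((C + 27) * H : ℕ) : ℝ) ^ 2 / N)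
      ≤ 2 * Real.sqrt n * Real.exp (32 * T * (C + 27) ^ 2) := by gcongr
    _ = _ := by ring

/-- The constants in the count of violations: a cube of side `l`, covered by `d` translates of a set
of `v` points, each of which carries the weight `p / (2 * E * s) ^ T`. -/
theorem mul_le_of_cube_bounds {T : ℕ} {B s E v d l p : ℝ} (hT : (0 : ℝ) < T) (hB : 0 < B)
    (hs : 0 < s) (hE : 0 < E) (hv : 0 ≤ v) (hp : 0 ≤ p) (hl : s / (12 * T) ≤ l)
    (hd : d ≤ 36 * T * (s / B)) (hcount : l ^ T ≤ d * v) :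
    (1 / (24 * T * E)) ^ T / (36 * T) * (B / s) * p ≤ v * (p / (2 * E * s) ^ T) := by
  have hlow : (s / (12 * T)) ^ T ≤ 36 * T * (s / B) * v :=
    (pow_le_pow_left₀ (by positivity) hl T).trans
      (hcount.trans (mul_le_mul_of_nonneg_right hd hv))
  have h1 : (1 / (24 * T * E)) ^ T = (s / (12 * T)) ^ T / (2 * E * s) ^ T := by
    rw [← div_pow]
    congr 1
    field_simp
    norm_num
  have h2 : (0 : ℝ) < (2 * E * s) ^ T := by positivity
  rw [h1]
  generalize (2 * E * s) ^ T = D at *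
  generalize (s / (12 * T)) ^ T = M at *
  have h3 : M * (B / (36 * T * s)) ≤ v := by
    calc M * (B / (36 * T * s)) ≤ 36 * T * (s / B) * v * (B / (36 * T * s)) :=
          mul_le_mul_of_nonneg_right hlow (by positivity)
      _ = v := by field_simp
  calc M / D / (36 * T) * (B / s) * p = M * (B / (36 * T * s)) * (p / D) := by field_simp
    _ ≤ _ := mul_le_mul_of_nonneg_right h3 (by positivity)

open Classical in
/-- For a fixed assignment `z` of pairs to the voters, with balanced mean margins and with all
classes of linear size, a fraction of order `B / √n` of the coin outcomes violates the axioms.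
Here `T` is the number of classes, `C` bounds the distance of the starting cube from the centres of
the classes, and `h * B` is of order `√n`. -/
theorem mul_two_pow_le_card_not_cAndP {m n h B C T : ℕ} (hm : 4 ≤ m) (r : VotingRule m)
    (hT : T = Fintype.card (Ranking m × Ranking m))
    (z : Fin n → Ranking m × Ranking m) (hB : 0 < B)
    (hHn : (h * B : ℝ) ≤ Real.sqrt n) (hnH : Real.sqrt n ≤ 3 * (h * B : ℝ))
    (hTH : 2 * T ≤ h * B) {b : ℝ} (hb : ∀ i j, |meanMargin z i j| ≤ b)
    (hC : (m : ℝ) ^ 2 * ((b + 80 * (h * B)) / 4) ≤ C * (h * B))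
    (hN : ∀ k, (n : ℝ) ≤ 2 * T * classCount z Finset.univ k)
    (hCN : ∀ k, 4 * ((C + 27) * (h * B)) ≤ classCount z Finset.univ k) :
    (1 / (24 * T * Real.exp (32 * T * (C + 27) ^ 2))) ^ T / (36 * T) *
        (B / Real.sqrt n) * 2 ^ n ≤
      ((Finset.univ.filter fun A : Finset (Fin n) =>
        ¬ CAndP m r n (coinProfile z A) B).card : ℝ) := by
  have hTpos : 0 < T := hT ▸ Fintype.card_pos
  set H : ℕ := h * B with hHdef
  have hHcast : (h * B : ℝ) = H := by rw [hHdef]; push_cast; rfl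
  rw [hHcast] at hHn hnH hC
  have hH1 : 1 ≤ H := by omega
  have hh1 : 1 ≤ h := by
    rcases Nat.eq_zero_or_pos h with rfl | h0
    · simp at hHdef; omega
    · exact h0
  have hHR : (1 : ℝ) ≤ H := by exact_mod_cast hH1
  have hs : (0 : ℝ) < Real.sqrt n := by linarith
  have hTR : (0 : ℝ) < T := by exact_mod_cast hTpos
  have hBR : (0 : ℝ) < B := by exact_mod_cast hB
  obtain ⟨w, hw, hwsum⟩ := exists_sum_swapMargin_eq
    (fun i j => 4 * (H : ℝ) * (antisymmetrize startMargin i j : ℤ) - meanMargin z i j)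
    (fun i j => by rw [antisymmetrize_swap, meanMargin_swap]; push_cast; ring)
    (b := b + 80 * H) (fun i j => by
      have h1 : |((antisymmetrize startMargin i j : ℤ) : ℝ)| ≤ 20 := by
        exact_mod_cast abs_antisymmetrize_startMargin_le i j
      refine (abs_sub _ _).trans ?_
      rw [abs_mul, abs_of_nonneg (by positivity : (0 : ℝ) ≤ 4 * H)]
      nlinarith [hb i j])
  replace hw : ∀ k, |w k| ≤ C * H := fun k => (hw k).trans hC
  set N : Ranking m × Ranking m → ℕ := classCount z Finset.univ with hNdef
  have hCNR : ∀ k, 4 * (((C : ℝ) + 27) * H) ≤ N k := fun k => by exact_mod_cast hCN k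
  -- A cube of this side length keeps the margins within `2 * T * l ≤ H` of their targets.
  obtain ⟨l, hl⟩ : ∃ l, l = H / (2 * T) := ⟨_, rfl⟩
  have hl1 : 1 ≤ l := by rw [hl]; exact (Nat.one_le_div_iff (by omega)).2 hTH
  have hl2 : 2 * T * l ≤ H := by rw [hl]; exact Nat.mul_div_le _ _
  have hl3 : H ≤ 4 * T * l := by
    have h1 := Nat.lt_mul_div_succ H (show 0 < 2 * T by omega)
    rw [← hl] at h1
    nlinarith
  have hlH : l ≤ H := by nlinarith
  have hCH : (0 : ℝ) ≤ C * H := by positivity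
  let c : Ranking m × Ranking m → ℕ := fun k => ⌈(N k : ℝ) / 2 + w k⌉₊
  have hc1 : ∀ k, (N k : ℝ) / 2 + w k ≤ c k := fun k => Nat.le_ceil _
  have hc2 : ∀ k, (c k : ℝ) < (N k : ℝ) / 2 + w k + 1 := fun k => by
    refine Nat.ceil_lt_add_one ?_
    have h1 := (abs_le.1 (hw k)).1
    have h2 := hCNR k
    nlinarith
  -- Every grid point that occurs lies within `(C + 27) * H` of the centre of the grid.
  have hrange : ∀ k (y : ℕ), c k ≤ y → y < c k + l + 25 * H →
      N k ≤ 2 * y + 2 * ((C + 27) * H) ∧ 2 * y ≤ N k + 2 * ((C + 27) * H) := by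
    intro k y h1 h2
    have h1' : (c k : ℝ) ≤ y := by exact_mod_cast h1
    have h2' : (y : ℝ) + 1 ≤ c k + l + 25 * H := by exact_mod_cast h2
    have h3 := abs_le.1 (hw k)
    have h4 := hc1 k
    have h5 := hc2 k
    have h6 : (l : ℝ) ≤ H := by exact_mod_cast hlH
    constructor
    · have : (N k : ℝ) ≤ 2 * y + 2 * ((C + 27) * H) := by nlinarith [h3.1]
      exact_mod_cast this
    · have : 2 * (y : ℝ) ≤ N k + 2 * ((C + 27) * H) := by nlinarith [h3.2]
      exact_mod_cast this
  have hxN : ∀ x : Ranking m × Ranking m → ℕ, (∀ k, c k ≤ x k ∧ x k < c k + l) →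
      ∀ k, x k + 25 * H ≤ N k := by
    intro x hx k
    have h1 := hrange k (x k + 25 * H) (by have := (hx k).1; omega)
      (by have := (hx k).2; omega)
    have h2 := hCN k
    have h3 := h1.2
    generalize (C + 27) * H = t at *
    omega
  refine (Nat.le_ceil _).trans (Nat.cast_le.2 (le_card_filter_of_forall_isGrid (z := z)
    (fun A => ¬ CAndP m r n (coinProfile z A) B) _ fun g hg => Nat.ceil_le.2 ?_))
  have hM : ∀ x : Ranking m × Ranking m → ℕ, (∀ k, c k ≤ x k ∧ x k < c k + l) →
      ∀ i j, |wmg (coinProfile z (g x)) i j -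
        4 * (H : ℤ) * antisymmetrize startMargin i j| < 2 * (H : ℤ) := by
    intro x hx i j
    have h1 := hg.wmg_eq_meanMargin_add (x := x)
      (fun k => le_trans (Nat.le_add_right _ _) (hxN x hx k)) i j
    have h2 : (wmg (coinProfile z (g x)) i j : ℝ) -
        4 * (H : ℝ) * (antisymmetrize startMargin i j : ℤ) =
        ∑ k, ((x k : ℝ) - (N k / 2 + w k)) * swapMargin k i j := by
      have h3 := hwsum i j
      rw [h1]
      simp_rw [sub_mul, add_mul, Finset.sum_sub_distrib, Finset.sum_add_distrib]
      rw [h3]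
      ring
    have h3 : |∑ k, ((x k : ℝ) - (N k / 2 + w k)) * swapMargin k i j| ≤
        ∑ _k : Ranking m × Ranking m, (l : ℝ) * 2 := by
      refine (Finset.abs_sum_le_sum_abs _ _).trans (Finset.sum_le_sum fun k _ => ?_)
      rw [abs_mul]
      refine mul_le_mul ?_ (by exact_mod_cast abs_swapMargin_le k i j) (abs_nonneg _)
        (Nat.cast_nonneg _)
      have h4 : (c k : ℝ) ≤ x k := by exact_mod_cast (hx k).1
      have h5 : (x k : ℝ) + 1 ≤ c k + l := by exact_mod_cast (hx k).2
      have h6 := hc1 k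
      have h7 := hc2 k
      exact abs_le.2 ⟨by linarith, by linarith⟩
    rw [Finset.sum_const, Finset.card_univ, ← hT, nsmul_eq_mul, ← h2] at h3
    have h4 : (2 * T * l : ℝ) ≤ H := by exact_mod_cast hl2
    have h5 : |(wmg (coinProfile z (g x)) i j : ℝ) -
        4 * (H : ℝ) * (antisymmetrize startMargin i j : ℤ)| < 2 * (H : ℝ) := by
      refine h3.trans_lt ?_
      nlinarith
    exact_mod_cast h5
  have hcount := hg.pow_le_card_displacements_mul hm r c hB hxN hM
  rw [← hT] at hcount
  set V := (Fintype.piFinset fun k => Finset.Ico (c k) (c k + l + 25 * (h * B))).filter fun y =>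
    ¬ CAndP m r n (coinProfile z (g y)) B with hV
  set E : ℝ := Real.exp (32 * T * (C + 27) ^ 2) with hE
  have hEpos : 0 < E := Real.exp_pos _
  have hNn : ∀ k, N k ≤ n := fun k => by
    rw [← sum_classCount z]
    exact Finset.single_le_sum (f := N) (fun _ _ => Nat.zero_le _) (Finset.mem_univ k)
  have hchoose : ∀ k (y : ℕ), c k ≤ y → y < c k + l + 25 * H →
      (2 : ℝ) ^ N k / (2 * E * Real.sqrt n) ≤ (N k).choose y := fun k y h1 h2 =>
    two_pow_div_le_choose (hNn k) hHn (hN k) hH1 (hCN k) (hrange k y h1 h2).1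
      (hrange k y h1 h2).2
  have hprod : ∀ y ∈ V, (2 : ℝ) ^ n / (2 * E * Real.sqrt n) ^ T ≤
      ∏ k, ((N k).choose (y k) : ℝ) := by
    intro y hy
    have h1 : ∀ k, c k ≤ y k ∧ y k < c k + l + 25 * H := fun k => by
      have := Fintype.mem_piFinset.1 (Finset.mem_filter.1 hy).1 k
      rwa [Finset.mem_Ico] at this
    calc (2 : ℝ) ^ n / (2 * E * Real.sqrt n) ^ T
        = ∏ k, (2 : ℝ) ^ N k / (2 * E * Real.sqrt n) := by
          rw [Finset.prod_div_distrib, Finset.prod_pow_eq_pow_sum, sum_classCount,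
            Finset.prod_const, Finset.card_univ, ← hT]
      _ ≤ _ := Finset.prod_le_prod (fun k _ => by positivity)
          fun k _ => hchoose k (y k) (h1 k).1 (h1 k).2
  have hfin := card_mul_le_card_classCount z
    (fun y => ¬ CAndP m r n (coinProfile z (g y)) B) V (fun y hy => (Finset.mem_filter.1 hy).2)
    hprod
  refine le_trans ?_ hfin
  have hΔ : ((displacements hm h B).card : ℝ) ≤ 36 * T * (Real.sqrt n / B) := by
    have h1 : (displacements hm h B).card ≤ 36 * T * h := by
      refine (card_displacements_le hm h B).trans ?_
      rw [← hT]
      nlinarith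
    have h2 : (h : ℝ) ≤ Real.sqrt n / B := by
      rw [le_div_iff₀ hBR, hHcast]
      exact hHn
    calc ((displacements hm h B).card : ℝ) ≤ 36 * T * h := by exact_mod_cast h1
      _ ≤ _ := by gcongr
  have hl4 : Real.sqrt n / (12 * T) ≤ l := by
    rw [div_le_iff₀ (by positivity)]
    have : (H : ℝ) ≤ 4 * T * l := by exact_mod_cast hl3
    linarith
  exact mul_le_of_cube_bounds hTR hBR hs hEpos (Nat.cast_nonneg _) (by positivity) hl4 hΔ
    (by exact_mod_cast hcount)

/-! ### Typical assignments of pairs -/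

theorem sum_voteMargin_eq_zero {m : ℕ} (i j : Fin m) :
    ∑ R : Ranking m, voteMargin R i j = 0 := by
  have h := Equiv.sum_comp (Equiv.mulRight (Equiv.swap i j)) fun R : Ranking m => voteMargin R i j
  have h2 : ∀ R : Ranking m, voteMargin (Equiv.mulRight (Equiv.swap i j) R) i j =
      - voteMargin R i j := fun R => by
    rw [← voteMargin_swap R i j]
    simp [voteMargin]
  rw [Finset.sum_congr rfl fun R _ => h2 R, Finset.sum_neg_distrib] at h
  linarith

open Classical in
/-- At least half of the assignments of pairs have mean margins of order `√n` and classes of linear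
size. -/
theorem half_le_card_typical {m n T : ℕ} (hm : 0 < m)
    (hT : T = Fintype.card (Ranking m × Ranking m)) (hn : 16 * T ^ 3 ≤ n) :
    (T : ℝ) ^ n / 2 ≤ ((Finset.univ.filter fun z : Fin n → Ranking m × Ranking m =>
      (∀ i j, |meanMargin z i j| ≤ 2 * m * Real.sqrt n) ∧
        ∀ k, (n : ℝ) ≤ 2 * T * classCount z Finset.univ k).card : ℝ) := by
  have hTpos : 0 < T := hT ▸ Fintype.card_pos
  have hTR : (0 : ℝ) < T := by exact_mod_cast hTpos
  have hmR : (0 : ℝ) < m := by exact_mod_cast hm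
  have hnpos : 0 < n := lt_of_lt_of_le (by positivity) hn
  have hnR : (0 : ℝ) < n := by exact_mod_cast hnpos
  -- The exceptional sets, with each of which Chebyshev's inequality deals.
  let X : Fin m × Fin m → Finset (Fin n → Ranking m × Ranking m) := fun p =>
    Finset.univ.filter fun z => 2 * m * Real.sqrt n ≤ |meanMargin z p.1 p.2|
  let Y : Ranking m × Ranking m → Finset (Fin n → Ranking m × Ranking m) := fun k =>
    Finset.univ.filter fun z =>
      (n : ℝ) / (2 * T) ≤ |(classCount z Finset.univ k : ℝ) - n / T|
  have hX : ∀ p, ((X p).card : ℝ) ≤ (T : ℝ) ^ n / (4 * m ^ 2) := by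
    intro p
    have h := card_le_abs_sum_mul_sq_le (K := Ranking m × Ranking m)
      (fun k => ((voteMargin k.1 p.1 p.2 + voteMargin k.2 p.1 p.2 : ℤ) : ℝ) / 2) (by
        have h0 : ((∑ R : Ranking m, voteMargin R p.1 p.2 : ℤ) : ℝ) = 0 := by
          rw [sum_voteMargin_eq_zero]; simp
        push_cast at h0
        rw [← Finset.sum_div, Fintype.sum_prod_type]
        push_cast
        simp_rw [Finset.sum_add_distrib, h0]
        simp [← Finset.mul_sum, h0]) (fun k => by
        have h1 := abs_le.1 (abs_voteMargin_le k.1 p.1 p.2)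
        have h2 := abs_le.1 (abs_voteMargin_le k.2 p.1 p.2)
        have h3 : |((voteMargin k.1 p.1 p.2 + voteMargin k.2 p.1 p.2 : ℤ) : ℝ)| ≤ 2 := by
          exact_mod_cast abs_le.2 ⟨by linarith, by linarith⟩
        rw [abs_div, abs_two]
        linarith) n (l := 2 * m * Real.sqrt n) (by positivity)
    rw [← hT, mul_pow, Real.sq_sqrt hnR.le] at h
    rw [le_div_iff₀ (by positivity)]
    refine le_of_mul_le_mul_left ?_ hnR
    calc (n : ℝ) * ((X p).card * (4 * m ^ 2)) = (X p).card * ((2 * m) ^ 2 * n) := by ring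
      _ ≤ _ := h
  have hY : ∀ k, ((Y k).card : ℝ) ≤ (T : ℝ) ^ n / (4 * T) := by
    intro k
    have hT1 : (1 : ℝ) ≤ T := by exact_mod_cast hTpos
    have hinv : (1 : ℝ) / T ≤ 1 := by rw [div_le_one hTR]; exact hT1
    have hinv0 : (0 : ℝ) < 1 / T := by positivity
    have h := card_le_abs_sum_mul_sq_le (K := Ranking m × Ranking m)
      (fun l => (if l = k then 1 else 0) - 1 / (T : ℝ)) (by
        rw [Finset.sum_sub_distrib, Finset.sum_const, Finset.card_univ, ← hT, nsmul_eq_mul,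
          Finset.sum_ite_eq' Finset.univ k]
        field_simp
        simp) (fun l => by
        split_ifs
        · exact abs_le.2 ⟨by linarith, by linarith⟩
        · exact abs_le.2 ⟨by linarith, by linarith⟩) n (l := (n : ℝ) / (2 * T)) (by positivity)
    have hsum : ∀ z : Fin n → Ranking m × Ranking m,
        ∑ i, ((if z i = k then 1 else 0) - 1 / (T : ℝ)) =
          (classCount z Finset.univ k : ℝ) - n / T := by
      intro z
      rw [Finset.sum_sub_distrib, Finset.sum_boole, Finset.sum_const, Finset.card_univ,
        Fintype.card_fin, nsmul_eq_mul]
      unfold classCount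
      rw [mul_one_div]
    simp_rw [hsum] at h
    rw [← hT] at h
    have hnT : (16 * T ^ 3 : ℝ) ≤ n := by exact_mod_cast hn
    rw [le_div_iff₀ (by positivity)]
    refine le_of_mul_le_mul_left ?_ hnR
    calc (n : ℝ) * ((Y k).card * (4 * T)) = (Y k).card * (4 * T * n) := by ring
      _ ≤ (Y k).card * ((n : ℝ) / (2 * T)) ^ 2 := by
          refine mul_le_mul_of_nonneg_left ?_ (Nat.cast_nonneg _)
          rw [div_pow, le_div_iff₀ (by positivity)]
          nlinarith
      _ ≤ _ := h
  set Z := Finset.univ.filter fun z : Fin n → Ranking m × Ranking m =>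
      (∀ i j, |meanMargin z i j| ≤ 2 * m * Real.sqrt n) ∧
        ∀ k, (n : ℝ) ≤ 2 * T * classCount z Finset.univ k with hZ
  have hcover : (Finset.univ : Finset (Fin n → Ranking m × Ranking m)) ⊆
      Z ∪ (Finset.univ.biUnion X ∪ Finset.univ.biUnion Y) := by
    intro z _
    by_contra hz
    simp only [Finset.mem_union, Finset.mem_biUnion, Finset.mem_univ, true_and, not_or,
      not_exists, X, Y, Finset.mem_filter, not_le, hZ] at hz
    refine hz.1 ⟨fun i j => (hz.2.1 (i, j)).le, fun k => ?_⟩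
    have h1 := (abs_lt.1 (hz.2.2 k)).1
    have h2 : (n : ℝ) / T = 2 * (n / (2 * T)) := by field_simp
    have h3 : (n : ℝ) / (2 * T) ≤ classCount z Finset.univ k := by linarith
    rw [div_le_iff₀ (by positivity)] at h3
    linarith
  have hcard := (Finset.card_le_card hcover).trans ((Finset.card_union_le _ _).trans
    (Nat.add_le_add_left ((Finset.card_union_le _ _).trans
      (Nat.add_le_add Finset.card_biUnion_le Finset.card_biUnion_le)) _))
  rw [Finset.card_univ, Fintype.card_fun, Fintype.card_fin, ← hT] at hcard
  have hcard' : (T : ℝ) ^ n ≤ Z.card + (∑ p, ((X p).card : ℝ) + ∑ k, ((Y k).card : ℝ)) := by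
    exact_mod_cast hcard
  have hXs : ∑ p, ((X p).card : ℝ) ≤ (T : ℝ) ^ n / 4 := by
    refine (Finset.sum_le_sum fun p _ => hX p).trans_eq ?_
    rw [Finset.sum_const, Finset.card_univ, Fintype.card_prod, Fintype.card_fin, nsmul_eq_mul]
    push_cast
    field_simp
  have hYs : ∑ k, ((Y k).card : ℝ) ≤ (T : ℝ) ^ n / 4 := by
    refine (Finset.sum_le_sum fun k _ => hY k).trans_eq ?_
    rw [Finset.sum_const, Finset.card_univ, ← hT, nsmul_eq_mul]
    field_simp
  linarith

/-! ### Counting profiles -/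

/-- Every profile arises from `(2 * m!) ^ n` choices of pairs and coins. -/
theorem card_coinProfile_eq_le {m n : ℕ} (P : Profile m n) :
    (Finset.univ.filter fun p : (Fin n → Ranking m × Ranking m) × Finset (Fin n) =>
      coinProfile p.1 p.2 = P).card ≤ (2 * m.factorial) ^ n := by
  let S : Ranking m → Finset ((Ranking m × Ranking m) × Bool) := fun R =>
    Finset.univ.image fun q : Ranking m × Bool =>
      if q.2 then ((q.1, R), true) else ((R, q.1), false)
  have hS : ∀ R, (S R).card ≤ 2 * m.factorial := fun R => by
    refine Finset.card_image_le.trans_eq ?_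
    rw [Finset.card_univ, Fintype.card_prod, Fintype.card_perm, Fintype.card_fin,
      Fintype.card_bool, mul_comm]
  calc _ ≤ (Fintype.piFinset fun i => S (P i)).card := by
        refine Finset.card_le_card_of_injOn (fun p i => (p.1 i, decide (i ∈ p.2))) ?_ ?_
        · rintro ⟨z, A⟩ hp
          have hP : coinProfile z A = P := (Finset.mem_filter.1 hp).2
          refine Finset.mem_coe.2 (Fintype.mem_piFinset.2 fun i => Finset.mem_image.2 ?_)
          rw [← hP]
          by_cases hi : i ∈ A
          · exact ⟨((z i).1, true), Finset.mem_univ _, by simp [coinProfile, hi]⟩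
          · exact ⟨((z i).2, false), Finset.mem_univ _, by simp [coinProfile, hi]⟩
        · rintro ⟨z, A⟩ _ ⟨z', A'⟩ _ h
          have h1 : ∀ i, z i = z' i ∧ (i ∈ A ↔ i ∈ A') := fun i => by
            have := congrFun h i
            simpa using this
          exact Prod.ext (funext fun i => (h1 i).1) (Finset.ext fun i => (h1 i).2)
    _ = ∏ i, (S (P i)).card := Fintype.card_piFinset _
    _ ≤ ∏ _i : Fin n, (2 * m.factorial) := Finset.prod_le_prod' fun i _ => hS _
    _ = _ := by rw [Finset.prod_const, Finset.card_univ, Fintype.card_fin]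

open Classical in
/-- A fraction of order `B / √n` of the profiles violates the two axioms. -/
theorem exists_mul_le_card_not_cAndP {m : ℕ} (hm : 4 ≤ m) :
    ∃ N : ℕ, ∃ c : ℝ, 0 < c ∧ ∀ r : VotingRule m, ∀ n : ℕ, N ≤ n → ∀ B : ℕ, 1 ≤ B →
      (B : ℝ) ≤ Real.sqrt n →
        c * (B / Real.sqrt n) * (m.factorial : ℝ) ^ n ≤
          ((Finset.univ.filter fun P : Profile m n => ¬ CAndP m r n P B).card : ℝ) := by
  obtain ⟨T, hT⟩ : ∃ T, T = Fintype.card (Ranking m × Ranking m) := ⟨_, rfl⟩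
  have hTq : T = m.factorial ^ 2 := by
    rw [hT, Fintype.card_prod, Fintype.card_perm, Fintype.card_fin, sq]
  have hTpos : 0 < T := hT ▸ Fintype.card_pos
  have hTR : (0 : ℝ) < T := by exact_mod_cast hTpos
  let C : ℕ := m ^ 2 * (2 * m + 20)
  let c₀ : ℝ := (1 / (24 * T * Real.exp (32 * T * (C + 27) ^ 2))) ^ T / (36 * T)
  have hc₀ : 0 < c₀ := by positivity
  refine ⟨(8 * T * (C + 27)) ^ 2 + 16 * T ^ 3, c₀ / 2, by positivity, fun r n hn B hB hBn => ?_⟩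
  set s := Nat.sqrt n with hs
  have hss : s * s ≤ n := Nat.sqrt_le n
  have hsT : 8 * T * (C + 27) ≤ s := Nat.le_sqrt'.2 (by omega)
  have hBs : B ≤ s := by
    refine Nat.le_sqrt'.2 ?_
    have := pow_le_pow_left₀ (Nat.cast_nonneg B) hBn 2
    rw [Real.sq_sqrt (Nat.cast_nonneg _)] at this
    exact_mod_cast this
  -- The unit of the margins has to be a multiple of the group size and of order `√n`.
  obtain ⟨h, hh⟩ : ∃ h, h = s / B := ⟨_, rfl⟩
  have hH1 : h * B ≤ s := hh ▸ Nat.div_mul_le_self s B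
  have hh1 : 1 ≤ h := hh ▸ (Nat.one_le_div_iff hB).2 hBs
  have hH2 : s < 2 * (h * B) := by
    have h1 := Nat.lt_mul_div_succ s hB
    rw [← hh] at h1
    nlinarith
  have hsn : (s : ℝ) ≤ Real.sqrt n := Real.nat_sqrt_le_real_sqrt
  have hns : Real.sqrt n ≤ s + 1 := Real.real_sqrt_le_nat_sqrt_succ
  have hHn : (h * B : ℝ) ≤ Real.sqrt n :=
    le_trans (by exact_mod_cast hH1) hsn
  have hnH : Real.sqrt n ≤ 3 * (h * B : ℝ) := by
    have h1 : (s : ℝ) + 1 ≤ 2 * (h * B) := by exact_mod_cast hH2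
    have h2 : (0 : ℝ) ≤ h * B := by positivity
    linarith
  have hTs : 4 * T ≤ s := le_trans (by nlinarith) hsT
  have hTH : 2 * T ≤ h * B := by omega
  have hC : (m : ℝ) ^ 2 * ((2 * m * Real.sqrt n + 80 * (h * B)) / 4) ≤ C * (h * B) := by
    have hm0 : (0 : ℝ) ≤ m := Nat.cast_nonneg _
    have h2 : (0 : ℝ) ≤ h * B := by positivity
    have h1 : (2 * m * Real.sqrt n + 80 * (h * B)) / 4 ≤ (2 * m + 20) * (h * B) := by
      have h3 := mul_le_mul_of_nonneg_left hnH hm0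
      have h4 := mul_nonneg hm0 h2
      nlinarith
    calc _ ≤ (m : ℝ) ^ 2 * ((2 * m + 20) * (h * B)) := by gcongr
      _ = C * (h * B) := by simp only [C]; push_cast; ring
  set Z := Finset.univ.filter fun z : Fin n → Ranking m × Ranking m =>
      (∀ i j, |meanMargin z i j| ≤ 2 * m * Real.sqrt n) ∧
        ∀ k, (n : ℝ) ≤ 2 * T * classCount z Finset.univ k with hZ
  have hZcard : (T : ℝ) ^ n / 2 ≤ Z.card := half_le_card_typical (by omega) hT (by omega)
  have hz : ∀ z ∈ Z, c₀ * (B / Real.sqrt n) * 2 ^ n ≤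
      ((Finset.univ.filter fun A : Finset (Fin n) =>
        ¬ CAndP m r n (coinProfile z A) B).card : ℝ) := by
    intro z hzZ
    obtain ⟨hz1, hz2⟩ := (Finset.mem_filter.1 hzZ).2
    refine mul_two_pow_le_card_not_cAndP hm r hT z hB hHn hnH hTH hz1 hC hz2 fun k => ?_
    have h1 : n ≤ 2 * T * classCount z Finset.univ k := by exact_mod_cast hz2 k
    refine Nat.le_of_mul_le_mul_left ?_ (show 0 < 2 * T by omega)
    calc 2 * T * (4 * ((C + 27) * (h * B))) = (8 * T * (C + 27)) * (h * B) := by ring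
      _ ≤ s * s := Nat.mul_le_mul hsT hH1
      _ ≤ n := hss
      _ ≤ _ := h1
  have hfib : (Finset.univ.filter fun p : (Fin n → Ranking m × Ranking m) × Finset (Fin n) =>
        ¬ CAndP m r n (coinProfile p.1 p.2) B).card ≤
      (2 * m.factorial) ^ n *
        (Finset.univ.filter fun P : Profile m n => ¬ CAndP m r n P B).card := by
    refine Finset.card_le_mul_card_image_of_maps_to (f := fun p => coinProfile p.1 p.2)
      (fun p hp => ?_) _ fun P _ => ?_
    · simpa using hp
    · exact (Finset.card_le_card (Finset.filter_subset_filter _ (Finset.filter_subset _ _))).trans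
        (card_coinProfile_eq_le P)
  have hpairs : ∑ z ∈ Z, (Finset.univ.filter fun A : Finset (Fin n) =>
        ¬ CAndP m r n (coinProfile z A) B).card ≤
      (Finset.univ.filter fun p : (Fin n → Ranking m × Ranking m) × Finset (Fin n) =>
        ¬ CAndP m r n (coinProfile p.1 p.2) B).card := by
    rw [Finset.card_filter, Fintype.sum_prod_type]
    simp_rw [← Finset.card_filter]
    exact Finset.sum_le_sum_of_subset (Finset.subset_univ _)
  have hq : (0 : ℝ) < m.factorial := by exact_mod_cast m.factorial_pos
  set D := ((Finset.univ.filter fun P : Profile m n => ¬ CAndP m r n P B).card : ℝ) with hD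
  have hfib' : (∑ z ∈ Z, ((Finset.univ.filter fun A : Finset (Fin n) =>
        ¬ CAndP m r n (coinProfile z A) B).card : ℝ)) ≤ (2 * m.factorial) ^ n * D := by
    rw [hD]
    exact_mod_cast hpairs.trans hfib
  have hbr : (0 : ℝ) ≤ B / Real.sqrt n := by positivity
  have hpow : (0 : ℝ) < (2 * m.factorial) ^ n := by positivity
  refine le_of_mul_le_mul_left ?_ hpow
  calc (2 * (m.factorial : ℝ)) ^ n * (c₀ / 2 * (B / Real.sqrt n) * (m.factorial : ℝ) ^ n)
      = (T : ℝ) ^ n / 2 * (c₀ * (B / Real.sqrt n) * 2 ^ n) := by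
        rw [hTq]; push_cast; rw [mul_pow, ← pow_mul, mul_comm 2 n, pow_mul]; ring
    _ ≤ Z.card * (c₀ * (B / Real.sqrt n) * 2 ^ n) := by gcongr
    _ = ∑ _z ∈ Z, c₀ * (B / Real.sqrt n) * 2 ^ n := by rw [Finset.sum_const, nsmul_eq_mul]
    _ ≤ _ := Finset.sum_le_sum hz
    _ ≤ _ := hfib'

end SemiRandomVoting

theorem theorem1 (m : ℕ) (hm : 4 ≤ m) :
    ∃ N : ℕ, ∀ Pi : Set (SemiRandomVoting.Ranking m → ℝ), SemiRandomVoting.IsAdmissible Pi →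
      ∃ c : ℝ, 0 < c ∧
        ∀ r : SemiRandomVoting.VotingRule m, ∀ n : ℕ, N ≤ n →
          ∀ B : ℕ, 1 ≤ B → (B : ℝ) ≤ Real.sqrt (n : ℝ) →
            SemiRandomVoting.satMin (SemiRandomVoting.CAndP m) Pi r n B
              ≤ 1 - c * ((B : ℝ) / Real.sqrt (n : ℝ)) := by
  obtain ⟨N, c, hc, hcount⟩ := SemiRandomVoting.exists_mul_le_card_not_cAndP hm
  refine ⟨N, fun Pi hPi => ⟨c, hc, fun r n hn B hB hBn => ?_⟩⟩
  refine (SemiRandomVoting.satMin_le_profileProb_uniform hPi _ r n B).trans ?_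
  rw [SemiRandomVoting.profileProb_uniform]
  refine sub_le_sub_left ?_ 1
  rw [le_div_iff₀ (by positivity)]
  exact hcount r n hn B hB hBn
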